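/- **Setting.** Let $d\ge 1$. A finite set of vertices is split into $m_1$ non-mortar contact vertices, $m_2$ mortar contact vertices and the remaining vertices; each vertex carries $d$ degrees of freedom, $n$ is the number of vertices, and $z\in\mathbb R^{dn}$ is ordered accordingly. Let $J:\mathbb R^{dn}\to\mathbb R$ (energy) and $c:\mathbb R^{dn}\to\mathbb R^{m_1}$ (contact constraint). The algebraic contact problem is to minimise $J$ subject to $c\ge 0$; a point $z$ is *first-order critical* for it if there is $\lambda\in\mathbb R^{m_1}$ with $\nabla J(z)+\lambda^T\nabla c(z)=0$, $c(z)\ge 0$, $\lambda\le 0$ and $\lambda_pc_p(z)=0$ for all $p$. The infeasibility is $\vartheta(z)=\max_p\{0,-c_p(z)\}$; a critical point of $\min\vartheta$ is a point at which the lower one-sided directional derivatives of $\vartheta$ are nonnegative in all directions. $\|\cdot\|$ denotes the maximum norm and the induced matrix norm. **Transformation.** Suppose that $\nabla c(z)=(D(z)\;\;M(z)\;\;0)$ on $\mathcal L$ (see (A1)) with respect to the above splitting. Let $O(z)$ be the block-diagonal matrix of the Householder reflections that map $e_1\in\mathbb R^d$ to given unit vectors $n_p(z)$, the contact normals. Let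 $N(z)$ be the $m_1\times m_1$ matrix of the first components of the $1\times d$ blocks of $D(z)O(z)$ (the normal non-mortar matrix), let $D_T(z)$ be the matrix of the other components, and let $\tilde N(z)$ be the diagonal matrix of the row sums of $N(z)$. Put $$T=\begin{pmatrix} OK&-OL&0\\0&I&0\\0&0&I\end{pmatrix},\quad K_{pq}=\begin{pmatrix}-(N^{-1})_{pq}&-(N^{-1}D_T)_{pq}\\0&\delta_{pq}I\end{pmatrix},\quad L_{pq}=\begin{pmatrix}(N^{-1}M)_{pq}\\0\end{pmatrix},$$ and let $\tilde T$ be given by the same formula with $\tilde N^{-1}$ instead of $N^{-1}$. The inexact model at $z$ is $\tilde m_z(v)=f_T(z)^Tv+\tfrac12 v^T\tilde H_T(z)v$ with $f_T=T^T\nabla J$ and $\tilde H_T=\tilde T^T\,\nabla^2J\,\tilde T$. The sub-problem at $z$ with radius $\Delta$ is to minimise $\tilde m_z(v)$ over all $v$ with $-\Delta\le v_i\le\Delta$ for all $i$, and $v_i\le c_p(z)$ if $i$ is the first degree of freedom of the non-mortar vertex $p$. **Method.** Fix $0<\xi<1$, $0<\eta_1\le\eta_2<1$, $0<\kappa_\vartheta<1$,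 $0<\gamma_0\le\gamma_1<1$. A point $z$ is acceptable to a set $F$ of pairs if for each $(J^i,\vartheta^i)\in F$ one has $J(z)<J^i-\xi\vartheta(z)$ or $\vartheta(z)<(1-\xi)\vartheta^i$. Adding $(J^k,\vartheta^k)$ to a filter removes all pairs $(J^i,\vartheta^i)$ in it with $J^k<J^i-\xi\vartheta^k$ and $\vartheta^k<(1-\xi)\vartheta^i$. Start with $z^0$, $\Delta^0>0$ and the empty filter $F^0$. Write $J^k=J(z^k)$ and $\vartheta^k=\vartheta(z^k)$. Iteration $k$ is as follows. * If $c_p(z^k)\ge-\Delta^k$ for all $p$: choose a feasible point $\tilde u^k$ of the sub-problem at $z^k$ with radius $\Delta^k$. Put $u^k=T(z^k)\tilde u^k$, $\mathrm{pred}^k=\tilde m_{z^k}(0)-\tilde m_{z^k}(\tilde u^k)$ and $\rho^k=(J(z^k)-J(z^k+u^k))/\mathrm{pred}^k$ (with $\rho^k=0$ if $\mathrm{pred}^k=0$). The candidate $z^k+u^k$ is rejected if it is not acceptable to the filter $F^k$ (the current pair $(J^k,\vartheta^k)$ may or may not be counted as a member in this test), or if $\rho^k<\eta_1$ and $\mathrm{pred}^k\ge\kappa_\vartheta(\vartheta^k)^2$.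 If it is rejected, then $z^{k+1}=z^k$, the filter is kept, and $\gamma_0\min\{\|\tilde u^k\|,\Delta^k\}\le\Delta^{k+1}\le\gamma_1\Delta^k$. If it is not rejected, then $z^{k+1}=z^k+u^k$; if moreover $\mathrm{pred}^k<\kappa_\vartheta(\vartheta^k)^2$, then $(J^k,\vartheta^k)$ is added to the filter and $\Delta^{k+1}=\Delta^k$; otherwise the filter is kept, $\Delta^{k+1}\ge\Delta^k$ if $\rho^k\ge\eta_2$, and $\Delta^{k+1}=\Delta^k$ if $\rho^k<\eta_2$. * If $c_p(z^k)<-\Delta^k$ for some $p$: $(J^k,\vartheta^k)$ is added to the filter, giving $F^{k+1}$, and the feasibility restoration phase is entered, i.e. some method for $\min\vartheta$ is started at $z^k$. The phase either terminates unsuccessfully, which means that none of its iterates is acceptable to $F^{k+1}$ and they converge to a critical point of $\min\vartheta$ (then the method ends), or it delivers one of its iterates as $z^{k+1}$, acceptable to $F^{k+1}$, and a radius $\Delta^{k+1}>0$ with $c_p(z^{k+1})\ge-\Delta^{k+1}$ for all $p$. **Theorem 4.1.** Assume: * (A1) all iterates $z^k$ lie in a compact set $\mathcal L$; * (A2) $J$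 and $c$ are twice continuously differentiable on an open set containing $\mathcal L$; * (A3) for $z\in\mathcal L$ the matrices $N(z)$ and $\tilde N(z)$ are invertible, and their inverses are bounded uniformly on $\mathcal L$; * (A4) there is a continuous function $\chi:\mathcal L\to[0,\infty)$ which, at each $z\in\mathcal L$ with $c(z)\ge0$, vanishes if and only if $0$ is a first-order stationary point of the sub-problem at $z$ (for any radius $\Delta>0$), and a constant $\kappa>0$ such that in every iteration of the first kind $$\mathrm{pred}^k\ \ge\ \kappa\,\chi(z^k)\min\Bigl\{\frac{\chi(z^k)}{\|\tilde H_T(z^k)\|},\,\Delta^k\Bigr\},$$ where the minimum is $\Delta^k$ if $\tilde H_T(z^k)=0$. Then either the feasibility restoration phase terminates unsuccessfully in some iteration, converging to a critical point of $\min\vartheta$; or the method generates an infinite sequence $(z^k)$, and some subsequence of it converges to a first-order critical point of the algebraic contact problem. -/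

import Mathlib

open Filter Topology
open scoped Matrix

noncomputable section

namespace FilterContact

/-! Vertices: `P` on the non-mortar contact boundary, `Q` on the mortar contact boundary, `R` all
others; each vertex carries `d` scalar degrees of freedom.  Vectors `DOF P Q R d → ℝ` carry the
maximum norm. -/

/-- Degrees of freedom, ordered as (non-mortar, mortar, other). -/
abbrev DOF (P Q R : Type*) (d : ℕ) : Type _ :=
  (P × Fin d) ⊕ ((Q × Fin d) ⊕ (R × Fin d))

/-- Operator norm of a square matrix induced by the maximum norm. -/
def opNorm {ι : Type*} [Fintype ι] [DecidableEq ι] (A : Matrix ι ι ℝ) : ℝ :=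
  ‖LinearMap.toContinuousLinearMap (Matrix.toLin' A)‖

section Derivatives

variable {ι P : Type*} [Fintype ι] [DecidableEq ι] [Fintype P]

/-- Gradient `∇J(z)`. -/
def grad (J : (ι → ℝ) → ℝ) (z : ι → ℝ) : ι → ℝ :=
  fun i => fderiv ℝ J z (Pi.single i 1)

/-- Hessian matrix `∇²J(z)`. -/
def hess (J : (ι → ℝ) → ℝ) (z : ι → ℝ) : Matrix ι ι ℝ :=
  Matrix.of fun i j => fderiv ℝ (fderiv ℝ J) z (Pi.single i 1) (Pi.single j 1)

/-- Jacobian matrix `∇c(z)`. -/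
def jac (c : (ι → ℝ) → P → ℝ) (z : ι → ℝ) : Matrix P ι ℝ :=
  Matrix.of fun p i => fderiv ℝ c z (Pi.single i 1) p

/-- Infeasibility `ϑ(z) = max {0, -c_p(z) : p}`; the index `none` stands for the entry `0`. -/
def infeas (c : (ι → ℝ) → P → ℝ) (z : ι → ℝ) : ℝ :=
  (Finset.univ : Finset (Option P)).sup' Finset.univ_nonempty
    (fun o => o.elim 0 (fun p => -c z p))

/-- Critical point of the non-smooth problem `min ϑ`: the lower directional derivative of `ϑ` is
nonnegative in every direction. -/
def InfeasCritical (c : (ι → ℝ) → P → ℝ) (w : ι → ℝ) : Prop :=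
  ∀ v : ι → ℝ, ∀ ε : ℝ, 0 < ε →
    ∀ᶠ t in 𝓝[>] (0 : ℝ), infeas c w - ε * t ≤ infeas c (w + t • v)

/-- First-order critical (KKT) point of `min J` subject to `c ≥ 0`. -/
def FirstOrderCritical (J : (ι → ℝ) → ℝ) (c : (ι → ℝ) → P → ℝ) (z : ι → ℝ) : Prop :=
  ∃ lam : P → ℝ, grad J z + lam ᵥ* jac c z = 0 ∧
    (∀ p, 0 ≤ c z p) ∧ (∀ p, lam p ≤ 0) ∧ ∀ p, lam p * c z p = 0

end Derivatives

section Transformation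

variable {P Q R : Type*} [Fintype P] [DecidableEq P] [Fintype Q] [DecidableEq Q]
  [Fintype R] [DecidableEq R] {d : ℕ} [NeZero d]

/-- Householder reflection that maps the first unit vector `e₁` to the unit vector `n`
(the identity if `n = e₁`, where the quotient is `2 / 0 = 0`). -/
def householder (n : Fin d → ℝ) : Matrix (Fin d) (Fin d) ℝ :=
  let v : Fin d → ℝ := Pi.single 0 1 - n
  1 - (2 / (v ⬝ᵥ v)) • Matrix.vecMulVec v v

/-- Block-diagonal matrix `O` of the Householder reflections of the vertex normals. -/
def rot (n : P → Fin d → ℝ) : Matrix (P × Fin d) (P × Fin d) ℝ :=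
  Matrix.of fun a b => if a.1 = b.1 then householder (n a.1) a.2 b.2 else 0

/-- Non-mortar part `D(z)` of the constraint Jacobian. -/
def nmPart (c : (DOF P Q R d → ℝ) → P → ℝ) (z : DOF P Q R d → ℝ) : Matrix P (P × Fin d) ℝ :=
  (jac c z).submatrix id Sum.inl

/-- Mortar part `M(z)` of the constraint Jacobian. -/
def mPart (c : (DOF P Q R d → ℝ) → P → ℝ) (z : DOF P Q R d → ℝ) : Matrix P (Q × Fin d) ℝ :=
  (jac c z).submatrix id (fun a => Sum.inr (Sum.inl a))

variable (c : (DOF P Q R d → ℝ) → P → ℝ) (nrm : (DOF P Q R d → ℝ) → P → Fin d → ℝ)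

/-- `D(z) O(z)`; the first column of each block is the normal part, the others are the
tangential part. -/
def nmRot (z : DOF P Q R d → ℝ) : Matrix P (P × Fin d) ℝ :=
  nmPart c z * rot (nrm z)

/-- Normal non-mortar matrix `D_N(z)`. -/
def nmNormal (z : DOF P Q R d → ℝ) : Matrix P P ℝ :=
  (nmRot c nrm z).submatrix id (fun q => (q, 0))

/-- Lumped (row sum) approximation of the normal non-mortar matrix. -/
def nmLumped (z : DOF P Q R d → ℝ) : Matrix P P ℝ :=
  Matrix.diagonal fun p => ∑ q, nmNormal c nrm z p q

/-- Decoupling transformation, with `Ninv` in the place of the inverse of `D_N(z)`. -/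
def transWith (Ninv : Matrix P P ℝ) (z : DOF P Q R d → ℝ) :
    Matrix (DOF P Q R d) (DOF P Q R d) ℝ :=
  let K : Matrix (P × Fin d) (P × Fin d) ℝ := Matrix.of fun a b =>
    if a.2 = 0 then
      if b.2 = 0 then -Ninv a.1 b.1 else -(Ninv * nmRot c nrm z) a.1 b
    else if a = b then 1 else 0
  let L : Matrix (P × Fin d) (Q × Fin d) ℝ := Matrix.of fun a b =>
    if a.2 = 0 then (Ninv * mPart c z) a.1 b else 0
  Matrix.fromBlocks (rot (nrm z) * K)
    (Matrix.fromCols (-(rot (nrm z) * L)) (0 : Matrix (P × Fin d) (R × Fin d) ℝ)) 0 1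

/-- Exact transformation `T(z)`. -/
def trans (z : DOF P Q R d → ℝ) : Matrix (DOF P Q R d) (DOF P Q R d) ℝ :=
  transWith c nrm (nmNormal c nrm z)⁻¹ z

/-- Inexact transformation, which uses the lumped matrix. -/
def transLumped (z : DOF P Q R d → ℝ) : Matrix (DOF P Q R d) (DOF P Q R d) ℝ :=
  transWith c nrm (nmLumped c nrm z)⁻¹ z

variable (J : (DOF P Q R d → ℝ) → ℝ)

/-- Exactly transformed gradient `f_T = ∇J(z)ᵀ T(z)`. -/
def gradT (z : DOF P Q R d → ℝ) : DOF P Q R d → ℝ :=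
  grad J z ᵥ* trans c nrm z

/-- Inexactly transformed Hessian of the energy. -/
def hessT (z : DOF P Q R d → ℝ) : Matrix (DOF P Q R d) (DOF P Q R d) ℝ :=
  (transLumped c nrm z)ᵀ * hess J z * transLumped c nrm z

/-- Inexact quadratic model at `z`, in transformed coordinates. -/
def model (z v : DOF P Q R d → ℝ) : ℝ :=
  gradT c nrm J z ⬝ᵥ v + 1 / 2 * (v ⬝ᵥ (hessT c nrm J z *ᵥ v))

/-- Upper bounds of the trust-region sub-problem: `min {c_p(z), Δ}` at the first degree of freedom
of the non-mortar vertex `p`, and `Δ` elsewhere. -/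
def upperBound (z : DOF P Q R d → ℝ) (Δ : ℝ) : DOF P Q R d → ℝ :=
  Sum.elim (fun a => if a.2 = 0 then min (c z a.1) Δ else Δ) (fun _ => Δ)

/-- Feasible set of the trust-region sub-problem at `z` with radius `Δ`. -/
def SubFeasible (z : DOF P Q R d → ℝ) (Δ : ℝ) (v : DOF P Q R d → ℝ) : Prop :=
  ∀ i, -Δ ≤ v i ∧ v i ≤ upperBound c z Δ i

/-- First-order stationary point of the trust-region sub-problem (variational inequality). -/
def SubStationary (z : DOF P Q R d → ℝ) (Δ : ℝ) (u : DOF P Q R d → ℝ) : Prop :=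
  SubFeasible c z Δ u ∧ ∀ v, SubFeasible c z Δ v →
    0 ≤ (gradT c nrm J z + hessT c nrm J z *ᵥ u) ⬝ᵥ (v - u)

/-- `χ` is an optimality measure of the sub-problems on `S`: a nonnegative continuous function
which, at a point `z` where the zero correction is feasible, vanishes if and only if the zero
correction is stationary for the sub-problem at `z`. -/
def IsOptimalityMeasure (S : Set (DOF P Q R d → ℝ)) (χ : (DOF P Q R d → ℝ) → ℝ) : Prop :=
  ContinuousOn χ S ∧ (∀ z ∈ S, 0 ≤ χ z) ∧
    ∀ z ∈ S, (∀ p, 0 ≤ c z p) → ∀ Δ > 0, (χ z = 0 ↔ SubStationary c nrm J z Δ 0)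

/-- `min {χ / h, Δ}`, with the value `Δ` if `h = 0`. -/
def cauchyLength (χ h Δ : ℝ) : ℝ :=
  if h = 0 then Δ else min (χ / h) Δ

end Transformation

section FilterMethod

/-- The pair `a` (energy, infeasibility) `ξ`-dominates the pair `b`. -/
def Dominates (ξ : ℝ) (a b : ℝ × ℝ) : Prop :=
  a.1 < b.1 - ξ * a.2 ∧ a.2 < (1 - ξ) * b.2

/-- The pair `a` is acceptable to the set `F` of pairs. -/
def Acceptable (ξ : ℝ) (F : Set (ℝ × ℝ)) (a : ℝ × ℝ) : Prop :=
  ∀ b ∈ F, a.1 < b.1 - ξ * a.2 ∨ a.2 < (1 - ξ) * b.2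

/-- Add the pair `a` to the filter `F` and remove the pairs that it dominates. -/
def addToFilter (ξ : ℝ) (F : Set (ℝ × ℝ)) (a : ℝ × ℝ) : Set (ℝ × ℝ) :=
  insert a {b ∈ F | ¬ Dominates ξ a b}

/-- Constants of the method: filter margin, acceptance thresholds for the approximation quality,
constant of the feasibility test, and bounds for the reduction of the radius. -/
structure Params where
  ξ : ℝ
  η₁ : ℝ
  η₂ : ℝ
  κθ : ℝ
  γ₀ : ℝ
  γ₁ : ℝ
  hξ : 0 < ξ ∧ ξ < 1
  hη : 0 < η₁ ∧ η₁ ≤ η₂ ∧ η₂ < 1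
  hκθ : 0 < κθ ∧ κθ < 1
  hγ : 0 < γ₀ ∧ γ₀ ≤ γ₁ ∧ γ₁ < 1

/-- The quantities that the method produces. -/
structure Trace (P Q R : Type*) (d : ℕ) where
  /-- iterates -/
  z : ℕ → DOF P Q R d → ℝ
  /-- trust-region radii -/
  Δ : ℕ → ℝ
  /-- approximate solutions of the sub-problems, in transformed coordinates -/
  u : ℕ → DOF P Q R d → ℝ
  /-- filters -/
  F : ℕ → Set (ℝ × ℝ)
  /-- the pairs against which the candidate is tested -/
  G : ℕ → Set (ℝ × ℝ)
  /-- iterates of the minimisation of the infeasibility, if it is started in iteration `k` -/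
  w : ℕ → ℕ → DOF P Q R d → ℝ

variable {P Q R : Type*} [Fintype P] [DecidableEq P] [Fintype Q] [DecidableEq Q]
  [Fintype R] [DecidableEq R] {d : ℕ} [NeZero d]
  (J : (DOF P Q R d → ℝ) → ℝ) (c : (DOF P Q R d → ℝ) → P → ℝ)
  (nrm : (DOF P Q R d → ℝ) → P → Fin d → ℝ)

/-- Pair of energy and infeasibility. -/
def pair (z : DOF P Q R d → ℝ) : ℝ × ℝ := (J z, infeas c z)

namespace Trace

variable (A : Params) (X : Trace P Q R d)

/-- Candidate `z^k + T(z^k) ũ^k`. -/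
def cand (k : ℕ) : DOF P Q R d → ℝ := X.z k + trans c nrm (X.z k) *ᵥ X.u k

/-- Predicted reduction. -/
def pred (k : ℕ) : ℝ := model c nrm J (X.z k) 0 - model c nrm J (X.z k) (X.u k)

/-- Approximation quality `ρ^k` (it is `0` if the predicted reduction vanishes). -/
def ratio (k : ℕ) : ℝ := (J (X.z k) - J (X.cand c nrm k)) / X.pred J c nrm k

/-- The sub-problem of iteration `k` is inadmissible: its linearised constraints are not
compatible with the trust region. -/
def Inadmissible (k : ℕ) : Prop := ∃ p, c (X.z k) p < -X.Δ k

/-- Feasibility test: the predicted reduction is at least `κ_ϑ (ϑ^k)²`. -/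
def FeasTest (k : ℕ) : Prop := A.κθ * infeas c (X.z k) ^ 2 ≤ X.pred J c nrm k

/-- The candidate of iteration `k` is rejected. -/
def Rejected (k : ℕ) : Prop :=
  ¬ Acceptable A.ξ (X.G k) (pair J c (X.cand c nrm k)) ∨
    (X.ratio J c nrm k < A.η₁ ∧ X.FeasTest J c nrm A k)

/-- The feasibility restoration phase is entered in iteration `k` and terminates unsuccessfully:
it never finds a point that is acceptable to the filter, and its iterates converge to a critical
point of the infeasibility. -/
def RestorationFails (k : ℕ) : Prop :=
  X.Inadmissible c k ∧ (∀ j, ¬ Acceptable A.ξ (X.F (k + 1)) (pair J c (X.w k j))) ∧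
    ∃ w : DOF P Q R d → ℝ, Tendsto (X.w k) atTop (𝓝 w) ∧ InfeasCritical c w

/-- Iteration `k` is reached: no earlier restoration phase has failed. -/
def Reached (k : ℕ) : Prop := ∀ j < k, ¬ X.RestorationFails J c A j

/-- Iteration with an admissible sub-problem. -/
structure RegularStep (k : ℕ) : Prop where
  feasible : SubFeasible c (X.z k) (X.Δ k) (X.u k)
  /-- the candidate is tested against the filter; whether the current pair counts as a member of
  it is left open -/
  test_lower : X.F k ⊆ X.G k
  test_upper : X.G k ⊆ insert (pair J c (X.z k)) (X.F k)
  /-- rejection: the radius is reduced -/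
  reject : X.Rejected J c nrm A k →
    X.z (k + 1) = X.z k ∧ X.F (k + 1) = X.F k ∧
      A.γ₀ * min ‖X.u k‖ (X.Δ k) ≤ X.Δ (k + 1) ∧ X.Δ (k + 1) ≤ A.γ₁ * X.Δ k
  /-- iteration of infeasibility type -/
  infeasType : ¬ X.Rejected J c nrm A k → ¬ X.FeasTest J c nrm A k →
    X.z (k + 1) = X.cand c nrm k ∧ X.F (k + 1) = addToFilter A.ξ (X.F k) (pair J c (X.z k)) ∧
      X.Δ (k + 1) = X.Δ k
  /-- iteration of energy type: the radius may be increased if the model is good -/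
  energyType : ¬ X.Rejected J c nrm A k → X.FeasTest J c nrm A k →
    X.z (k + 1) = X.cand c nrm k ∧ X.F (k + 1) = X.F k ∧ X.Δ k ≤ X.Δ (k + 1) ∧
      (X.ratio J c nrm k < A.η₂ → X.Δ (k + 1) = X.Δ k)

/-- Iteration with an inadmissible sub-problem: the current pair is added to the filter and the
infeasibility is minimised, starting from the current iterate.  Unless it terminates
unsuccessfully, the phase stops at a point that is acceptable to the filter, together with a
radius for which the sub-problem is admissible. -/
structure RestorationStep (k : ℕ) : Prop where
  filter : X.F (k + 1) = addToFilter A.ξ (X.F k) (pair J c (X.z k))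
  start : X.w k 0 = X.z k
  success : ¬ X.RestorationFails J c A k →
    (∃ j, X.z (k + 1) = X.w k j) ∧ Acceptable A.ξ (X.F (k + 1)) (pair J c (X.z (k + 1))) ∧
      0 < X.Δ (k + 1) ∧ ¬ X.Inadmissible c (k + 1)

/-- `X` is generated by the filter–trust-region method with inexactly transformed Hessians. -/
structure IsRun : Prop where
  radius_zero : 0 < X.Δ 0
  filter_zero : X.F 0 = ∅
  regular : ∀ k, X.Reached J c A k → ¬ X.Inadmissible c k → X.RegularStep J c nrm A k
  restoration : ∀ k, X.Reached J c A k → X.Inadmissible c k → X.RestorationStep J c A k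

end Trace

end FilterMethod

end FilterContact

end

noncomputable section

namespace FilterContact

set_option linter.unusedSectionVars false

/-! ### The decoupling transformation and the passage from stationarity to the KKT conditions. -/

section LinearAlgebra

/-! The transformation $T$ satisfies $\nabla c\,T=-(\text{normal components})$ (`jac_mul_trans`).
Hence the linearised constraint is a simple bound, and a feasible step of radius $\Delta$ leaves an
infeasibility of order $\Delta^2$ only. The gradient in the model is exact, so the error of the
model is also of order $\Delta^2$ as long as the inexact Hessian is bounded (`exists_modelBounds`).
Since $T$ is invertible, stationarity of $0$ at a feasible point is the KKT system with multiplier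
$\lambda_p=(f_T)_{(p,0)}$ (`firstOrderCritical_of_stationary`).

It remains to find iterates at which $\vartheta$ and $\chi$ are both small. Otherwise, for some
$\varepsilon>0$, eventually $\vartheta\le\varepsilon$ implies $\chi\ge\varepsilon$. The Cauchy
decrease is then linear in small $\Delta$ and beats all errors of order $\Delta^2$, so that only an
old filter pair can cause the rejection of a short step (`exists_smallRadius`).

If the filter grows infinitely often, compactness makes $\vartheta$ tend to zero along the additions
(`infeas_lt_of_adds`). Late additions are then all due to restoration, and the iteration that
precedes one would need an infeasibility that is at once linear and quadratic in $\Delta$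
(`not_frequently_adds`). If the filter is eventually constant, its infeasibilities are bounded away
from zero, so that radii stay bounded below while $\vartheta\le\varepsilon$. Either infinitely many
accepted steps drive $J$ to $-\infty$ on a compact set, or endless rejection drives the radius to
zero; both are impossible (`not_eventually_not_adds`). A radius that becomes exactly zero is a
separate case, in which the iteration has stopped at a critical point. -/

theorem householder_mul_self {d : ℕ} [NeZero d] (n : Fin d → ℝ) :
    householder n * householder n = 1 := by
  unfold householder
  extract_lets v
  have h2 : Matrix.vecMulVec v v * Matrix.vecMulVec v v = (v ⬝ᵥ v) • Matrix.vecMulVec v v := by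
    rw [Matrix.vecMulVec_mul_vecMulVec, Matrix.vecMulVec_smul]
  -- Here the coefficient is $2/0=0$ and the matrix is the identity.
  by_cases h : v ⬝ᵥ v = 0
  · simp [h]
  · rw [sub_mul, mul_sub, mul_sub, mul_one, mul_one, one_mul, Matrix.smul_mul, Matrix.mul_smul,
      h2, smul_smul, smul_smul]
    have : 2 / (v ⬝ᵥ v) * (2 / (v ⬝ᵥ v)) * (v ⬝ᵥ v) = 2 / (v ⬝ᵥ v) + 2 / (v ⬝ᵥ v) := by
      field_simp; norm_num
    rw [this, add_smul]
    abel

theorem abs_householder_le {d : ℕ} [NeZero d] (n : Fin d → ℝ) (i j : Fin d) :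
    |householder n i j| ≤ 3 := by
  set v : Fin d → ℝ := Pi.single 0 1 - n with hv
  have hsq : ∀ i, v i ^ 2 ≤ v ⬝ᵥ v := fun i => by
    rw [sq]
    exact Finset.single_le_sum (f := fun i => v i * v i) (fun i _ => mul_self_nonneg _)
      (Finset.mem_univ i)
  have h0 : 0 ≤ v ⬝ᵥ v := (sq_nonneg _).trans (hsq i)
  have h1 : |v i * v j| ≤ v ⬝ᵥ v := by
    rw [abs_le]
    constructor <;> nlinarith [hsq i, hsq j, sq_nonneg (v i + v j), sq_nonneg (v i - v j)]
  have h2 : |2 / (v ⬝ᵥ v) * (v i * v j)| ≤ 2 := by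
    rcases h0.eq_or_lt with h | h
    · rw [← h]; simp
    · rw [abs_mul, abs_of_pos (by positivity), div_mul_eq_mul_div, div_le_iff₀ h]
      linarith
  have h3 : |(1 : Matrix (Fin d) (Fin d) ℝ) i j| ≤ 1 := by
    rw [Matrix.one_apply]; split_ifs <;> simp
  calc _ = |(1 : Matrix (Fin d) (Fin d) ℝ) i j - 2 / (v ⬝ᵥ v) * (v i * v j)| := by
        simp [householder, Matrix.vecMulVec_apply, ← hv]
    _ ≤ _ := (abs_sub _ _).trans (by linarith)

variable {P Q R : Type*} [Fintype P] [DecidableEq P] [Fintype Q] [DecidableEq Q]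
  [Fintype R] [DecidableEq R] {d : ℕ} [NeZero d]

theorem rot_mul_self (n : P → Fin d → ℝ) : rot n * rot n = 1 := by
  ext ⟨p, i⟩ ⟨q, j⟩
  rw [Matrix.mul_apply, Fintype.sum_prod_type]
  simp only [rot, Matrix.of_apply]
  rw [Finset.sum_eq_single p (fun b _ hb => by simp [hb.symm]) (by simp)]
  by_cases hpq : p = q
  · subst hpq
    have := congrFun (congrFun (householder_mul_self (n p)) i) j
    rw [Matrix.mul_apply] at this
    simp only [if_true, this, Matrix.one_apply, Prod.mk.injEq, true_and]
  · simp [hpq]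

variable {c : (DOF P Q R d → ℝ) → P → ℝ} {nrm : (DOF P Q R d → ℝ) → P → Fin d → ℝ}
  {z : DOF P Q R d → ℝ}

theorem jac_eq_fromCols (hc0 : ∀ (p : P) (a : R × Fin d), jac c z p (Sum.inr (Sum.inr a)) = 0) :
    jac c z = Matrix.fromCols (nmPart c z)
      (Matrix.fromCols (mPart c z) (0 : Matrix P (R × Fin d) ℝ)) := by
  ext p i
  rcases i with a | a | a
  · rfl
  · rfl
  · simp [hc0]

/-- Leading block of the decoupling transformation. -/
def transK (c : (DOF P Q R d → ℝ) → P → ℝ) (nrm : (DOF P Q R d → ℝ) → P → Fin d → ℝ)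
    (Ninv : Matrix P P ℝ) (z : DOF P Q R d → ℝ) : Matrix (P × Fin d) (P × Fin d) ℝ :=
  Matrix.of fun a b =>
    if a.2 = 0 then
      if b.2 = 0 then -Ninv a.1 b.1 else -(Ninv * nmRot c nrm z) a.1 b
    else if a = b then 1 else 0

/-- Coupling block of the decoupling transformation. -/
def transL (c : (DOF P Q R d → ℝ) → P → ℝ) (Ninv : Matrix P P ℝ) (z : DOF P Q R d → ℝ) :
    Matrix (P × Fin d) (Q × Fin d) ℝ :=
  Matrix.of fun a b => if a.2 = 0 then (Ninv * mPart c z) a.1 b else 0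

theorem transWith_eq (Ninv : Matrix P P ℝ) :
    transWith c nrm Ninv z = Matrix.fromBlocks (rot (nrm z) * transK c nrm Ninv z)
      (Matrix.fromCols (-(rot (nrm z) * transL c Ninv z)) (0 : Matrix (P × Fin d) (R × Fin d) ℝ))
      0 1 := rfl

theorem sum_nmNormal_mul (p : P) (V : P → ℝ) :
    ∑ q, nmNormal c nrm z p q * V q
      = ∑ a : P × Fin d, nmRot c nrm z p a * (if a.2 = 0 then V a.1 else 0) := by
  rw [Fintype.sum_prod_type]
  refine Finset.sum_congr rfl fun q _ => ?_
  rw [Finset.sum_eq_single 0 (fun b _ hb => by simp [hb]) (by simp)]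
  simp [nmNormal]

/-- This is $NN^{-1}B=B$, with $N^{-1}B$ placed in the normal rows and zeros in the tangential ones.
-/
theorem sum_nmRot_mul_inv {κ : Type*} (hN : IsUnit (nmNormal c nrm z)) (B : Matrix P κ ℝ) (p : P)
    (k : κ) : ∑ a : P × Fin d, nmRot c nrm z p a *
      (if a.2 = 0 then ((nmNormal c nrm z)⁻¹ * B) a.1 k else 0) = B p k := by
  have hinv : nmNormal c nrm z * (nmNormal c nrm z)⁻¹ = 1 :=
    Matrix.mul_nonsing_inv _ ((Matrix.isUnit_iff_isUnit_det _).1 hN)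
  rw [← sum_nmNormal_mul p (fun q => ((nmNormal c nrm z)⁻¹ * B) q k), ← Matrix.mul_apply,
    ← Matrix.mul_assoc, hinv, Matrix.one_mul]

/-- The transformed constraint Jacobian picks the normal non-mortar components. -/
theorem jac_mul_trans (hN : IsUnit (nmNormal c nrm z))
    (hc0 : ∀ (p : P) (a : R × Fin d), jac c z p (Sum.inr (Sum.inr a)) = 0) :
    jac c z * trans c nrm z = Matrix.of fun p i => if i = Sum.inl (p, 0) then -1 else 0 := by
  rw [jac_eq_fromCols hc0, trans, transWith_eq]
  set K := transK c nrm (nmNormal c nrm z)⁻¹ z with hK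
  set L := transL c (nmNormal c nrm z)⁻¹ z with hL
  rw [Matrix.fromCols_mul_fromBlocks, ← Matrix.mul_assoc, Matrix.mul_fromCols]
  ext p i
  rcases i with a | a | a
  · simp only [Matrix.fromCols_apply_inl, Matrix.mul_zero, add_zero, Matrix.of_apply,
      Sum.inl.injEq]
    change (nmRot c nrm z * K) p a = _
    rw [Matrix.mul_apply]
    -- A normal column yields $-NN^{-1}$, a tangential column $D_T-NN^{-1}D_T=0$.
    by_cases ha : a.2 = 0
    · have h1 := sum_nmRot_mul_inv hN 1 p a.1
      simp only [Matrix.mul_one] at h1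
      have h2 : ∀ b : P × Fin d, nmRot c nrm z p b * K b a
          = -(nmRot c nrm z p b * (if b.2 = 0 then (nmNormal c nrm z)⁻¹ b.1 a.1 else 0)) := by
        intro b
        by_cases hb : b.2 = 0
        · simp [hK, transK, ha, hb]
        · have : b ≠ a := fun h => hb (h ▸ ha)
          simp [hK, transK, hb, this]
      rw [Finset.sum_congr rfl fun b _ => h2 b, Finset.sum_neg_distrib, h1, Matrix.one_apply]
      have : a = (p, 0) ↔ p = a.1 := by
        rw [Prod.ext_iff]; simp [ha, eq_comm]
      simp only [this]
      split_ifs <;> simp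
    · have h1 := sum_nmRot_mul_inv hN (nmRot c nrm z) p a
      have h2 : ∀ b : P × Fin d, nmRot c nrm z p b * K b a
          = (if b = a then nmRot c nrm z p b else 0) -
          (nmRot c nrm z p b *
            (if b.2 = 0 then ((nmNormal c nrm z)⁻¹ * nmRot c nrm z) b.1 a else 0)) := by
        intro b
        by_cases hb : b.2 = 0
        · have : b ≠ a := fun h => ha (h ▸ hb)
          simp [hK, transK, ha, hb, this]
        · simp [hK, transK, hb]
      rw [Finset.sum_congr rfl fun b _ => h2 b, Finset.sum_sub_distrib, h1]
      have : a ≠ (p, 0) := fun h => ha (by rw [h])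
      simp [this]
  · have h1 := sum_nmRot_mul_inv hN (mPart c z) p a
    have h2 : (nmPart c z * -(rot (nrm z) * L)) p a = - mPart c z p a := by
      rw [Matrix.mul_neg, ← Matrix.mul_assoc, Matrix.neg_apply]
      change -(nmRot c nrm z * L) p a = _
      rw [Matrix.mul_apply, ← h1]
      rfl
    rw [Matrix.mul_neg, Matrix.neg_apply] at h2
    simp [h2]
  · simp

/-- $T$ is block triangular with an identity block, $O$ is an involution, and $K$ is triangular with
respect to the splitting into normal and tangential components. The equations are therefore solved
in the order normal, tangential, remaining. -/
theorem trans_vecMul_injective (hN : IsUnit (nmNormal c nrm z)) {g : DOF P Q R d → ℝ}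
    (hg : g ᵥ* trans c nrm z = 0) : g = 0 := by
  have hinv : (nmNormal c nrm z)⁻¹ * nmNormal c nrm z = 1 :=
    Matrix.nonsing_inv_mul _ ((Matrix.isUnit_iff_isUnit_det _).1 hN)
  rw [trans, transWith_eq] at hg
  set K := transK c nrm (nmNormal c nrm z)⁻¹ z with hK
  rw [Matrix.vecMul_fromBlocks] at hg
  have hP : (g ∘ Sum.inl) ᵥ* (rot (nrm z) * K) = 0 := by
    ext a
    simpa using congrFun hg (Sum.inl a)
  rw [← Matrix.vecMul_vecMul] at hP
  set w := (g ∘ Sum.inl) ᵥ* rot (nrm z) with hw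
  have hw0 : (fun p => w (p, 0)) = 0 := by
    have h1 : (fun p => w (p, 0)) ᵥ* (nmNormal c nrm z)⁻¹ = 0 := by
      ext q
      have h := congrFun hP (q, 0)
      rw [Matrix.vecMul, dotProduct, Fintype.sum_prod_type] at h
      rw [Matrix.vecMul, dotProduct, Pi.zero_apply, ← neg_eq_zero, ← Finset.sum_neg_distrib]
      refine (Finset.sum_congr rfl fun p _ => ?_).trans h
      rw [Finset.sum_eq_single 0 (fun b _ hb => by simp [hK, transK, hb]) (by simp)]
      simp [hK, transK]
    have h2 := congrArg (fun v => v ᵥ* nmNormal c nrm z) h1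
    simpa [Matrix.vecMul_vecMul, hinv] using h2
  have hwz : w = 0 := by
    ext ⟨q, j⟩
    by_cases hj : j = 0
    · subst hj; exact congrFun hw0 q
    · have h := congrFun hP (q, j)
      rw [Matrix.vecMul, dotProduct, Finset.sum_eq_single (q, j) _ (by simp)] at h
      · simpa [hK, transK, hj] using h
      · rintro ⟨p, i⟩ - hne
        by_cases hi : i = 0
        · subst hi
          have : w (p, 0) = 0 := congrFun hw0 p
          simp [this]
        · simp only [hK, transK, Matrix.of_apply, hi, if_false, if_neg hne, mul_zero]
  have hgP : g ∘ Sum.inl = 0 := by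
    have h2 := congrArg (fun v => v ᵥ* rot (nrm z)) hw
    rw [hwz] at h2
    simpa [Matrix.vecMul_vecMul, rot_mul_self] using h2.symm
  ext i
  rcases i with a | a
  · exact congrFun hgP a
  · have h := congrFun hg (Sum.inr a)
    rw [hgP] at h
    simpa using h

/-- The feasible set is a box that contains $0$, so the variational inequality can be tested one
coordinate at a time. The value $-1$ is always allowed; a positive value is allowed unless the
constraint is active. -/
theorem gradT_apply_of_stationary {J : (DOF P Q R d → ℝ) → ℝ} (hc : ∀ p, 0 ≤ c z p)
    (h : SubStationary c nrm J z 1 0) :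
    (∀ i, (∀ p, i ≠ Sum.inl (p, 0)) → gradT c nrm J z i = 0) ∧
      ∀ p, gradT c nrm J z (Sum.inl (p, 0)) ≤ 0 ∧
        gradT c nrm J z (Sum.inl (p, 0)) * c z p = 0 := by
  obtain ⟨-, h⟩ := h
  have hub : ∀ i, 0 ≤ upperBound c z 1 i := by
    rintro (a | a)
    · simp only [upperBound, Sum.elim_inl]
      split_ifs
      · exact le_min (hc _) zero_le_one
      · exact zero_le_one
    · simp [upperBound]
  have hs : ∀ i t, -1 ≤ t → t ≤ upperBound c z 1 i → 0 ≤ gradT c nrm J z i * t := by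
    intro i t ht1 ht2
    have := h (Pi.single i t) (fun j => by
      by_cases hj : j = i
      · subst hj; simp [ht1, ht2]
      · simp [hj, hub j])
    simpa using this
  have hle : ∀ i, gradT c nrm J z i ≤ 0 := fun i => by
    have := hs i (-1) le_rfl (by linarith [hub i])
    linarith
  refine ⟨fun i hi => ?_, fun p => ⟨hle _, ?_⟩⟩
  · have h1 : upperBound c z 1 i = 1 := by
      rcases i with ⟨p, j⟩ | a
      · have : j ≠ 0 := fun hj => hi p (by rw [hj])
        simp [upperBound, this]
      · simp [upperBound]
    have := hs i 1 (by norm_num) h1.ge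
    linarith [hle i]
  · rcases (hc p).eq_or_lt with h0 | h0
    · rw [← h0, mul_zero]
    · have hm : 0 < min (c z p) 1 := lt_min h0 one_pos
      have := hs (Sum.inl (p, 0)) (min (c z p) 1) (by linarith) (by simp [upperBound])
      have h1 : 0 ≤ gradT c nrm J z (Sum.inl (p, 0)) := nonneg_of_mul_nonneg_left this hm
      rw [le_antisymm (hle _) h1, zero_mul]

/-- A feasible point at which the zero correction is stationary is a first-order critical point. -/
theorem firstOrderCritical_of_stationary {J : (DOF P Q R d → ℝ) → ℝ}
    (hN : IsUnit (nmNormal c nrm z))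
    (hc0 : ∀ (p : P) (a : R × Fin d), jac c z p (Sum.inr (Sum.inr a)) = 0)
    (hc : ∀ p, 0 ≤ c z p) (h : SubStationary c nrm J z 1 0) : FirstOrderCritical J c z := by
  obtain ⟨h1, h2⟩ := gradT_apply_of_stationary hc h
  refine ⟨fun p => gradT c nrm J z (Sum.inl (p, 0)), trans_vecMul_injective hN ?_, hc,
    fun p => (h2 p).1, fun p => (h2 p).2⟩
  rw [Matrix.add_vecMul, Matrix.vecMul_vecMul, jac_mul_trans hN hc0]
  ext i
  change gradT c nrm J z i + _ = 0
  by_cases hi : ∃ p, i = Sum.inl (p, 0)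
  · obtain ⟨p, rfl⟩ := hi
    rw [Matrix.vecMul, dotProduct, Finset.sum_eq_single p _ (by simp)]
    · simp
    · intro q _ hq
      simp [hq.symm]
  · push Not at hi
    rw [h1 i hi, zero_add, Matrix.vecMul, dotProduct]
    exact Finset.sum_eq_zero fun p _ => by simp [hi p]

end LinearAlgebra

/-! ### Entrywise bounds of matrices and a uniform Taylor estimate. -/

section Bounds

/-- The entries of the matrices `A z` are bounded uniformly for `z ∈ S`. -/
def EntriesBoundedOn {E m n : Type*} (S : Set E) (A : E → Matrix m n ℝ) : Prop :=
  ∃ C, 0 ≤ C ∧ ∀ z ∈ S, ∀ i j, |A z i j| ≤ C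

namespace EntriesBoundedOn

variable {E m n k : Type*} {S : Set E}

theorem mul [Fintype n] {A : E → Matrix m n ℝ} {B : E → Matrix n k ℝ}
    (hA : EntriesBoundedOn S A) (hB : EntriesBoundedOn S B) :
    EntriesBoundedOn S fun z => A z * B z := by
  obtain ⟨a, ha0, ha⟩ := hA
  obtain ⟨b, hb0, hb⟩ := hB
  refine ⟨Fintype.card n * (a * b), by positivity, fun z hz i j => ?_⟩
  change |(A z * B z) i j| ≤ _
  rw [Matrix.mul_apply]
  refine (Finset.abs_sum_le_sum_abs _ _).trans ?_
  refine (Finset.sum_le_card_nsmul _ _ (a * b) fun l _ => ?_).trans (by simp)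
  rw [abs_mul]
  exact mul_le_mul (ha z hz i l) (hb z hz l j) (abs_nonneg _) ha0

theorem neg {A : E → Matrix m n ℝ} (hA : EntriesBoundedOn S A) :
    EntriesBoundedOn S fun z => -A z := by
  obtain ⟨a, ha0, ha⟩ := hA
  exact ⟨a, ha0, fun z hz i j => by simpa using ha z hz i j⟩

theorem transpose {A : E → Matrix m n ℝ} (hA : EntriesBoundedOn S A) :
    EntriesBoundedOn S fun z => (A z)ᵀ := by
  obtain ⟨a, ha0, ha⟩ := hA
  exact ⟨a, ha0, fun z hz i j => ha z hz j i⟩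

theorem submatrix {m' n' : Type*} {A : E → Matrix m n ℝ} (hA : EntriesBoundedOn S A) (f : m' → m)
    (g : n' → n) : EntriesBoundedOn S fun z => (A z).submatrix f g := by
  obtain ⟨a, ha0, ha⟩ := hA
  exact ⟨a, ha0, fun z hz i j => ha z hz _ _⟩

theorem of_continuousOn [TopologicalSpace E] [Finite m] [Finite n] {A : E → Matrix m n ℝ}
    (hS : IsCompact S) (hA : ∀ i j, ContinuousOn (fun z => A z i j) S) :
    EntriesBoundedOn S A := by
  cases nonempty_fintype m
  cases nonempty_fintype n
  choose C hC using fun i j => hS.exists_bound_of_continuousOn (hA i j)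
  refine ⟨∑ i, ∑ j, |C i j|, by positivity, fun z hz i j => (hC i j z hz).trans ?_⟩
  calc C i j ≤ |C i j| := le_abs_self _
    _ ≤ ∑ j, |C i j| := Finset.single_le_sum (f := fun j => |C i j|)
        (fun _ _ => abs_nonneg _) (Finset.mem_univ j)
    _ ≤ _ := Finset.single_le_sum (f := fun i => ∑ j, |C i j|)
        (fun _ _ => by positivity) (Finset.mem_univ i)

end EntriesBoundedOn

theorem abs_apply_le_opNorm {ι : Type*} [Fintype ι] [DecidableEq ι] (A : Matrix ι ι ℝ) (i j : ι) :
    |A i j| ≤ opNorm A := by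
  have h := (LinearMap.toContinuousLinearMap (Matrix.toLin' A)).le_opNorm (Pi.single j 1)
  have h1 : ‖(Pi.single j 1 : ι → ℝ)‖ ≤ 1 := by
    refine (pi_norm_le_iff_of_nonneg zero_le_one).2 fun k => ?_
    by_cases hk : k = j
    · subst hk; simp
    · simp [hk]
  have h2 := norm_le_pi_norm (A *ᵥ Pi.single j 1) i
  have h3 : (A *ᵥ Pi.single j 1) i = A i j := by simp
  rw [h3, Real.norm_eq_abs] at h2
  have h4 : ‖A *ᵥ Pi.single j 1‖ ≤ opNorm A * ‖(Pi.single j 1 : ι → ℝ)‖ := h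
  have h5 : 0 ≤ opNorm A := norm_nonneg _
  nlinarith

theorem norm_mulVec_le {m n : Type*} [Fintype m] [Fintype n] {A : Matrix m n ℝ} {C : ℝ}
    (hC : 0 ≤ C) (hA : ∀ i j, |A i j| ≤ C) (v : n → ℝ) :
    ‖A *ᵥ v‖ ≤ Fintype.card n * C * ‖v‖ := by
  refine (pi_norm_le_iff_of_nonneg (by positivity)).2 fun i => ?_
  rw [Real.norm_eq_abs, Matrix.mulVec, dotProduct]
  refine (Finset.abs_sum_le_sum_abs _ _).trans ?_
  refine (Finset.sum_le_card_nsmul _ _ (C * ‖v‖) fun l _ => ?_).trans (by simp [mul_assoc])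
  rw [abs_mul]
  exact mul_le_mul (hA i l) (norm_le_pi_norm v l) (abs_nonneg _) hC

theorem opNorm_le {ι : Type*} [Fintype ι] [DecidableEq ι] {A : Matrix ι ι ℝ} {C : ℝ}
    (hC : 0 ≤ C) (hA : ∀ i j, |A i j| ≤ C) : opNorm A ≤ Fintype.card ι * C :=
  ContinuousLinearMap.opNorm_le_bound _ (by positivity) fun v => norm_mulVec_le hC hA v

theorem abs_dotProduct_le {n : Type*} [Fintype n] (v w : n → ℝ) :
    |v ⬝ᵥ w| ≤ Fintype.card n * (‖v‖ * ‖w‖) := by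
  rw [dotProduct]
  refine (Finset.abs_sum_le_sum_abs _ _).trans ?_
  refine (Finset.sum_le_card_nsmul _ _ (‖v‖ * ‖w‖) fun l _ => ?_).trans (by simp)
  rw [abs_mul]
  exact mul_le_mul (norm_le_pi_norm v l) (norm_le_pi_norm w l) (abs_nonneg _) (norm_nonneg _)

/-- Second-order Taylor estimate, uniform on a compact subset of the domain. -/
theorem exists_taylor_bound {E F : Type*} [NormedAddCommGroup E] [NormedSpace ℝ E]
    [ProperSpace E] [NormedAddCommGroup F] [NormedSpace ℝ F] {f : E → F} {L U : Set E}
    (hL : IsCompact L) (hU : IsOpen U) (hLU : L ⊆ U) (hf : ContDiffOn ℝ 2 f U) :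
    ∃ C r : ℝ, 0 ≤ C ∧ 0 < r ∧ ∀ z ∈ L, ∀ s : E, ‖s‖ ≤ r →
      ‖f (z + s) - f z - fderiv ℝ f z s‖ ≤ C * ‖s‖ ^ 2 := by
  -- The compact thickening contains every ball of radius at most `r` around a point of `L`, so one
  -- bound of the second derivative serves all these balls.
  obtain ⟨r, hr, hrU⟩ := hL.exists_cthickening_subset_open hU hLU
  have hK : IsCompact (Metric.cthickening r L) := hL.cthickening
  have hf1 : ContDiffOn ℝ 1 (fderiv ℝ f) U := hf.fderiv_of_isOpen hU (by norm_num)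
  have hf2 : ContinuousOn (fderiv ℝ (fderiv ℝ f)) U :=
    hf1.continuousOn_fderiv_of_isOpen hU le_rfl
  obtain ⟨C, hC⟩ := hK.exists_bound_of_continuousOn
    (E := E →L[ℝ] E →L[ℝ] F) (hf2.mono hrU)
  refine ⟨|C|, r, abs_nonneg _, hr, fun z hz s hs => ?_⟩
  have hball : Metric.closedBall z ‖s‖ ⊆ U := fun x hx =>
    hrU (Metric.closedBall_subset_cthickening hz r (Metric.closedBall_subset_closedBall hs hx))
  have hconv : Convex ℝ (Metric.closedBall z ‖s‖) := convex_closedBall z _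
  have hzb : z ∈ Metric.closedBall z ‖s‖ := Metric.mem_closedBall_self (norm_nonneg _)
  have hsb : z + s ∈ Metric.closedBall z ‖s‖ := by simp [Metric.mem_closedBall]
  have hd1 : ∀ x ∈ Metric.closedBall z ‖s‖, DifferentiableAt ℝ (fderiv ℝ f) x := fun x hx =>
    (hf1.contDiffAt (hU.mem_nhds (hball hx))).differentiableAt (by norm_num)
  have hd : ∀ x ∈ Metric.closedBall z ‖s‖, DifferentiableAt ℝ f x := fun x hx =>
    (hf.contDiffAt (hU.mem_nhds (hball hx))).differentiableAt (by norm_num)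
  have hlip : ∀ x ∈ Metric.closedBall z ‖s‖, ‖fderiv ℝ f x - fderiv ℝ f z‖ ≤ |C| * ‖s‖ := by
    intro x hx
    refine (hconv.norm_image_sub_le_of_norm_fderiv_le (C := |C|) hd1 (fun y hy => ?_) hzb hx).trans
      ?_
    · exact (hC y (Metric.closedBall_subset_cthickening hz r
        (Metric.closedBall_subset_closedBall hs hy))).trans (le_abs_self C)
    · gcongr
      rwa [← dist_eq_norm]
  have := hconv.norm_image_sub_le_of_norm_fderiv_le' hd hlip hzb hsb
  rw [add_sub_cancel_left] at this
  linarith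

end Bounds

/-! ### Uniform errors of the model and of the linearised constraint. -/

section ModelBounds

variable {P Q R : Type*} [Fintype P] [DecidableEq P] [Fintype Q] [DecidableEq Q]
  [Fintype R] [DecidableEq R] {d : ℕ} [NeZero d]
  {J : (DOF P Q R d → ℝ) → ℝ} {c : (DOF P Q R d → ℝ) → P → ℝ}
  {nrm : (DOF P Q R d → ℝ) → P → Fin d → ℝ} {L U : Set (DOF P Q R d → ℝ)}

theorem entriesBoundedOn_rot (S : Set (DOF P Q R d → ℝ)) :
    EntriesBoundedOn S fun z => rot (nrm z) := by
  refine ⟨3, by norm_num, fun z _ a b => ?_⟩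
  change |(rot (nrm z)) a b| ≤ _
  rw [rot, Matrix.of_apply]
  split_ifs
  · exact abs_householder_le _ _ _
  · simp

/-- No continuity of the normals is assumed, so $T$ need not be continuous on `L`. Boundedness is
instead propagated through the products that define it. -/
theorem entriesBoundedOn_transWith (hD : EntriesBoundedOn L fun z => jac c z)
    {B : (DOF P Q R d → ℝ) → Matrix P P ℝ} (hB : EntriesBoundedOn L B) :
    EntriesBoundedOn L fun z => transWith c nrm (B z) z := by
  have hO := entriesBoundedOn_rot (nrm := nrm) L
  have hM := hB.mul (hD.submatrix (id : P → P) fun a : Q × Fin d => Sum.inr (Sum.inl a))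
  have hT := hB.mul ((hD.submatrix (id : P → P) (Sum.inl : P × Fin d → DOF P Q R d)).mul hO)
  have hK : EntriesBoundedOn L fun z => transK c nrm (B z) z := by
    obtain ⟨b, hb0, hb⟩ := hB
    obtain ⟨t, ht0, ht⟩ := hT
    refine ⟨max (max b t) 1, by positivity, fun z hz i j => ?_⟩
    change |(transK c nrm (B z) z) i j| ≤ _
    rw [transK, Matrix.of_apply]
    split_ifs
    · rw [abs_neg]; exact (hb z hz _ _).trans (by simp)
    · rw [abs_neg]; exact (ht z hz _ _).trans (by simp)
    · simp
    · simp
  have hL' : EntriesBoundedOn L fun z => transL c (B z) z := by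
    obtain ⟨m, hm0, hm⟩ := hM
    refine ⟨m, hm0, fun z hz i j => ?_⟩
    change |(transL c (B z) z) i j| ≤ _
    rw [transL, Matrix.of_apply]
    split_ifs
    · exact hm z hz _ _
    · simpa using hm0
  obtain ⟨k, hk0, hk⟩ := hO.mul hK
  obtain ⟨l, hl0, hl⟩ := (hO.mul hL').neg
  refine ⟨max (max k l) 1, by positivity, fun z hz i j => ?_⟩
  change |(transWith c nrm (B z) z) i j| ≤ _
  rw [transWith_eq]
  rcases i with i | i <;> rcases j with j | j
  · exact (hk z hz i j).trans (by simp)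
  · rcases j with j | j
    · exact (hl z hz i j).trans (by simp)
    · simp only [Matrix.fromBlocks_apply₁₂, Matrix.fromCols_apply_inr, Matrix.zero_apply, abs_zero]
      positivity
  · simp only [Matrix.fromBlocks_apply₂₁, Matrix.zero_apply, abs_zero]
    positivity
  · simp only [Matrix.fromBlocks_apply₂₂, Matrix.one_apply]
    split_ifs <;> simp

theorem entriesBoundedOn_inv {B : (DOF P Q R d → ℝ) → Matrix P P ℝ} {κ : ℝ}
    (hB : ∀ z ∈ L, IsUnit (B z) ∧ opNorm (B z)⁻¹ ≤ κ) : EntriesBoundedOn L fun z => (B z)⁻¹ :=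
  ⟨|κ|, abs_nonneg _, fun z hz i j =>
    (abs_apply_le_opNorm _ i j).trans ((hB z hz).2.trans (le_abs_self κ))⟩

theorem entriesBoundedOn_jac (hL : IsCompact L) (hU : IsOpen U) (hLU : L ⊆ U)
    (hc : ContDiffOn ℝ 2 c U) : EntriesBoundedOn L fun z => jac c z := by
  refine EntriesBoundedOn.of_continuousOn hL fun p i => ?_
  have h := (hc.continuousOn_fderiv_of_isOpen hU (by norm_num)).mono hLU
  exact (continuous_apply p).comp_continuousOn (h.clm_apply continuousOn_const)

theorem entriesBoundedOn_hess (hL : IsCompact L) (hU : IsOpen U) (hLU : L ⊆ U)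
    (hJ : ContDiffOn ℝ 2 J U) : EntriesBoundedOn L fun z => hess J z := by
  refine EntriesBoundedOn.of_continuousOn hL fun i j => ?_
  have hf1 : ContDiffOn ℝ 1 (fderiv ℝ J) U := hJ.fderiv_of_isOpen hU (by norm_num)
  have h := (hf1.continuousOn_fderiv_of_isOpen hU le_rfl).mono hLU
  exact (h.clm_apply continuousOn_const).clm_apply continuousOn_const

theorem fderiv_eq_grad_dotProduct {ι : Type*} [Fintype ι] [DecidableEq ι] (f : (ι → ℝ) → ℝ)
    (z v : ι → ℝ) : fderiv ℝ f z v = grad f z ⬝ᵥ v := by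
  conv_lhs => rw [pi_eq_sum_univ' v]
  simp [grad, dotProduct, mul_comm]

theorem fderiv_eq_jac_mulVec {ι : Type*} [Fintype ι] [DecidableEq ι]
    (f : (ι → ℝ) → P → ℝ) (z v : ι → ℝ) : fderiv ℝ f z v = jac f z *ᵥ v := by
  conv_lhs => rw [pi_eq_sum_univ' v]
  ext p
  simp [jac, Matrix.mulVec, dotProduct, mul_comm]

theorem SubFeasible.norm_le {z u : DOF P Q R d → ℝ} {Δ : ℝ} (hΔ : 0 ≤ Δ)
    (h : SubFeasible c z Δ u) : ‖u‖ ≤ Δ := by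
  refine (pi_norm_le_iff_of_nonneg hΔ).2 fun i => ?_
  rw [Real.norm_eq_abs, abs_le]
  refine ⟨(h i).1, (h i).2.trans ?_⟩
  rcases i with a | a
  · simp only [upperBound, Sum.elim_inl]
    split_ifs
    · exact min_le_right _ _
    · exact le_rfl
  · exact le_rfl

theorem infeas_nonneg {ι : Type*} [Fintype ι] [DecidableEq ι] (c : (ι → ℝ) → P → ℝ)
    (z : ι → ℝ) : 0 ≤ infeas c z :=
  Finset.le_sup' (fun o : Option P => o.elim 0 (fun p => -c z p)) (Finset.mem_univ none)

theorem infeas_le_iff {ι : Type*} [Fintype ι] [DecidableEq ι] {c : (ι → ℝ) → P → ℝ}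
    {z : ι → ℝ} {a : ℝ} (ha : 0 ≤ a) : infeas c z ≤ a ↔ ∀ p, -a ≤ c z p := by
  rw [infeas, Finset.sup'_le_iff]
  constructor
  · intro h p
    have := h (some p) (Finset.mem_univ _)
    simp only [Option.elim_some] at this
    linarith
  · rintro h (_ | p) -
    · exact ha
    · simpa using neg_le.1 (h p)

theorem model_zero (z : DOF P Q R d → ℝ) : model c nrm J z 0 = 0 := by simp [model]

/-- Uniform bounds for the models, and for the errors of the linearisation of the constraint and
of the quadratic model. -/
structure ModelBounds (J : (DOF P Q R d → ℝ) → ℝ) (c : (DOF P Q R d → ℝ) → P → ℝ)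
    (nrm : (DOF P Q R d → ℝ) → P → Fin d → ℝ) (L : Set (DOF P Q R d → ℝ)) (B r : ℝ) : Prop where
  one_le : 1 ≤ B
  pos : 0 < r
  le_one : r ≤ 1
  hess_le : ∀ z ∈ L, opNorm (hessT c nrm J z) ≤ B
  model_le : ∀ z ∈ L, ∀ u, |model c nrm J z u| ≤ B * (‖u‖ + ‖u‖ ^ 2)
  infeas_le : ∀ z ∈ L, ∀ Δ, 0 ≤ Δ → Δ ≤ r → ∀ u, SubFeasible c z Δ u →
    infeas c (z + trans c nrm z *ᵥ u) ≤ B * Δ ^ 2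
  energy_le : ∀ z ∈ L, ∀ Δ, 0 ≤ Δ → Δ ≤ r → ∀ u, SubFeasible c z Δ u →
    |J (z + trans c nrm z *ᵥ u) - J z - model c nrm J z u| ≤ B * Δ ^ 2

/-- Taylor's formula is applied to the step $Tu$, whose length is at most a fixed multiple of
$\Delta$. -/
theorem exists_modelBounds (hL : IsCompact L) (hU : IsOpen U) (hLU : L ⊆ U)
    (hJ : ContDiffOn ℝ 2 J U) (hc : ContDiffOn ℝ 2 c U)
    (hc0 : ∀ z ∈ L, ∀ (p : P) (a : R × Fin d), jac c z p (Sum.inr (Sum.inr a)) = 0)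
    (κN : ℝ) (hN : ∀ z ∈ L, IsUnit (nmNormal c nrm z) ∧ opNorm (nmNormal c nrm z)⁻¹ ≤ κN)
    (hNl : ∀ z ∈ L, IsUnit (nmLumped c nrm z) ∧ opNorm (nmLumped c nrm z)⁻¹ ≤ κN) :
    ∃ B r, ModelBounds J c nrm L B r := by
  have hD := entriesBoundedOn_jac hL hU hLU hc
  have hT : EntriesBoundedOn L fun z => trans c nrm z :=
    entriesBoundedOn_transWith hD (entriesBoundedOn_inv hN)
  have hTl : EntriesBoundedOn L fun z => transLumped c nrm z :=
    entriesBoundedOn_transWith hD (entriesBoundedOn_inv hNl)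
  obtain ⟨h, hh0, hh⟩ : EntriesBoundedOn L fun z => hessT c nrm J z :=
    (hTl.transpose.mul (entriesBoundedOn_hess hL hU hLU hJ)).mul hTl
  have hg : EntriesBoundedOn L fun z => Matrix.of fun (_ : Unit) i => grad J z i := by
    refine EntriesBoundedOn.of_continuousOn hL fun _ i => ?_
    exact ((hJ.continuousOn_fderiv_of_isOpen hU (by norm_num)).mono hLU).clm_apply
      continuousOn_const
  obtain ⟨g, hg0, hg⟩ := hg.mul hT
  obtain ⟨t, ht0, ht⟩ := hT
  obtain ⟨C₁, r₁, hC₁, hr₁, hJt⟩ := exists_taylor_bound hL hU hLU hJ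
  obtain ⟨C₂, r₂, hC₂, hr₂, hct⟩ := exists_taylor_bound hL hU hLU hc
  set n : ℝ := (Fintype.card (DOF P Q R d) : ℝ) with hn
  have hn0 : 0 ≤ n := Nat.cast_nonneg _
  set τ : ℝ := n * t with hτ
  have hτ0 : 0 ≤ τ := by positivity
  have hTu : ∀ z ∈ L, ∀ u, ‖trans c nrm z *ᵥ u‖ ≤ τ * ‖u‖ := fun z hz u =>
    norm_mulVec_le ht0 (ht z hz) u
  have hquad : ∀ z ∈ L, ∀ u, |1 / 2 * (u ⬝ᵥ (hessT c nrm J z *ᵥ u))| ≤ n * (n * h) * ‖u‖ ^ 2 := by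
    intro z hz u
    rw [abs_mul]
    have h1 := abs_dotProduct_le u (hessT c nrm J z *ᵥ u)
    have h2 := norm_mulVec_le hh0 (hh z hz) u
    have h3 : n * (‖u‖ * ‖hessT c nrm J z *ᵥ u‖) ≤ n * (‖u‖ * (n * h * ‖u‖)) := by gcongr
    have h4 : |(1 / 2 : ℝ)| = 1 / 2 := abs_of_pos (by norm_num)
    rw [h4]
    have h5 : 0 ≤ |u ⬝ᵥ (hessT c nrm J z *ᵥ u)| := abs_nonneg _
    nlinarith
  have hlin : ∀ z ∈ L, ∀ u, |gradT c nrm J z ⬝ᵥ u| ≤ n * g * ‖u‖ := by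
    intro z hz u
    have h1 : ‖gradT c nrm J z‖ ≤ g := by
      refine (pi_norm_le_iff_of_nonneg hg0).2 fun i => ?_
      exact hg z hz () i
    refine (abs_dotProduct_le _ _).trans ?_
    rw [← hn, mul_assoc]
    gcongr
  -- The denominator is `τ + 1` because `τ` may vanish.
  have hsmall : ∀ z ∈ L, ∀ Δ, 0 ≤ Δ → Δ ≤ min r₁ r₂ / (τ + 1) → ∀ u, SubFeasible c z Δ u →
      ‖trans c nrm z *ᵥ u‖ ≤ min r₁ r₂ ∧ ‖trans c nrm z *ᵥ u‖ ^ 2 ≤ τ ^ 2 * Δ ^ 2 := by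
    intro z hz Δ hΔ0 hΔ u hu
    have h1 : ‖trans c nrm z *ᵥ u‖ ≤ τ * Δ :=
      (hTu z hz u).trans (mul_le_mul_of_nonneg_left (hu.norm_le hΔ0) hτ0)
    rw [le_div_iff₀ (by positivity)] at hΔ
    refine ⟨by nlinarith, ?_⟩
    rw [← mul_pow]
    exact pow_le_pow_left₀ (norm_nonneg _) h1 2
  refine ⟨1 + n * h + n * g + n * (n * h) + C₁ * τ ^ 2 + C₂ * τ ^ 2,
    min (min r₁ r₂ / (τ + 1)) 1, ?_, ?_, min_le_right _ _, ?_, ?_, ?_, ?_⟩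
  · have : 0 ≤ n * h + n * g + n * (n * h) + C₁ * τ ^ 2 + C₂ * τ ^ 2 := by positivity
    linarith
  · have := lt_min hr₁ hr₂
    positivity
  · intro z hz
    have : 0 ≤ n * g + n * (n * h) + C₁ * τ ^ 2 + C₂ * τ ^ 2 := by positivity
    linarith [opNorm_le hh0 (hh z hz)]
  · intro z hz u
    have h1 := abs_add_le (gradT c nrm J z ⬝ᵥ u) (1 / 2 * (u ⬝ᵥ (hessT c nrm J z *ᵥ u)))
    have h2 : 0 ≤ (1 + n * h + C₁ * τ ^ 2 + C₂ * τ ^ 2) * (‖u‖ + ‖u‖ ^ 2) := by positivity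
    have h3 : 0 ≤ n * g * ‖u‖ ^ 2 := by positivity
    have h4 : 0 ≤ n * (n * h) * ‖u‖ := by positivity
    rw [model]
    nlinarith [hquad z hz u, hlin z hz u]
  · intro z hz Δ hΔ0 hΔ u hu
    obtain ⟨h1, h2⟩ := hsmall z hz Δ hΔ0 (hΔ.trans (min_le_left _ _)) u hu
    have h3 := hct z hz _ (h1.trans (min_le_right _ _))
    have h4 : C₂ * ‖trans c nrm z *ᵥ u‖ ^ 2 ≤ C₂ * (τ ^ 2 * Δ ^ 2) := by gcongr
    have h5 : 0 ≤ (1 + n * h + n * g + n * (n * h) + C₁ * τ ^ 2) * Δ ^ 2 := by positivity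
    rw [infeas_le_iff (by positivity)]
    intro p
    have h6 := (norm_le_pi_norm _ p).trans h3
    -- To first order $c_p$ changes by exactly $-u_{(p,0)}\ge -c_p(z)$, so only the Taylor remainder
    -- can violate the constraint.
    have h7 : (fderiv ℝ c z (trans c nrm z *ᵥ u)) p = -u (Sum.inl (p, 0)) := by
      rw [fderiv_eq_jac_mulVec, Matrix.mulVec_mulVec, jac_mul_trans (hN z hz).1 (hc0 z hz),
        Matrix.mulVec, dotProduct, Finset.sum_eq_single (Sum.inl (p, 0))]
      · simp
      · intro i _ hi
        simp [hi]
      · simp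
    have h8 : u (Sum.inl (p, 0)) ≤ c z p := by
      have := (hu (Sum.inl (p, 0))).2
      simp only [upperBound, Sum.elim_inl, if_true] at this
      exact this.trans (min_le_left _ _)
    simp only [Pi.sub_apply, h7, Real.norm_eq_abs] at h6
    have h9 := (abs_le.1 h6).1
    nlinarith
  · intro z hz Δ hΔ0 hΔ u hu
    obtain ⟨h1, h2⟩ := hsmall z hz Δ hΔ0 (hΔ.trans (min_le_left _ _)) u hu
    have h3 := hJt z hz _ (h1.trans (min_le_left _ _))
    have h4 : C₁ * ‖trans c nrm z *ᵥ u‖ ^ 2 ≤ C₁ * (τ ^ 2 * Δ ^ 2) := by gcongr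
    have h5 : 0 ≤ (1 + n * h + n * g + C₂ * τ ^ 2) * Δ ^ 2 := by positivity
    -- The linear terms of energy and model coincide; the inexact quadratic term is itself of order
    -- $\Delta^2$.
    have h6 : fderiv ℝ J z (trans c nrm z *ᵥ u) = gradT c nrm J z ⬝ᵥ u := by
      rw [fderiv_eq_grad_dotProduct, Matrix.dotProduct_mulVec]; rfl
    have h7 : n * (n * h) * ‖u‖ ^ 2 ≤ n * (n * h) * Δ ^ 2 := by
      have := hu.norm_le hΔ0
      gcongr
    rw [h6, Real.norm_eq_abs] at h3
    have h8 := abs_sub (J (z + trans c nrm z *ᵥ u) - J z - gradT c nrm J z ⬝ᵥ u)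
      (1 / 2 * (u ⬝ᵥ (hessT c nrm J z *ᵥ u)))
    rw [model, ← sub_sub]
    nlinarith [hquad z hz u]

end ModelBounds

/-! ### The filter, and the degenerate case of a vanishing radius. -/

section FilterFacts

theorem Acceptable.mono {ξ : ℝ} {F G : Set (ℝ × ℝ)} {b : ℝ × ℝ} (h : Acceptable ξ G b)
    (hFG : F ⊆ G) : Acceptable ξ F b := fun a ha => h a (hFG ha)

/-- The pairs that are removed from a filter are not needed for the acceptance test. -/
theorem Acceptable.of_addToFilter {ξ : ℝ} (hξ : 0 < ξ ∧ ξ < 1) {F : Set (ℝ × ℝ)} {a b : ℝ × ℝ}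
    (ha : 0 ≤ a.2) (h : Acceptable ξ (addToFilter ξ F a) b) :
    Acceptable ξ F b := by
  intro f hf
  by_cases hd : Dominates ξ a f
  · have h1 : 0 ≤ ξ * a.2 := mul_nonneg hξ.1.le ha
    rcases h a (Set.mem_insert _ _) with h2 | h2
    · exact Or.inl (by linarith [hd.1])
    · exact Or.inr (by linarith [hd.2])
  · exact h f (Set.mem_insert_of_mem _ ⟨hf, hd⟩)

variable {P Q R : Type*} [Fintype P] [DecidableEq P] [Fintype Q] [DecidableEq Q]
  [Fintype R] [DecidableEq R] {d : ℕ} [NeZero d]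
  {J : (DOF P Q R d → ℝ) → ℝ} {c : (DOF P Q R d → ℝ) → P → ℝ}
  {nrm : (DOF P Q R d → ℝ) → P → Fin d → ℝ} {L : Set (DOF P Q R d → ℝ)}
  {A : Params} {X : Trace P Q R d} {χ : (DOF P Q R d → ℝ) → ℝ} {κ : ℝ}

namespace Trace

/-- A pair is added to the filter in iteration `k`. -/
def Adds (J : (DOF P Q R d → ℝ) → ℝ) (c : (DOF P Q R d → ℝ) → P → ℝ)
    (nrm : (DOF P Q R d → ℝ) → P → Fin d → ℝ) (A : Params) (X : Trace P Q R d) (k : ℕ) : Prop :=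
  X.Inadmissible c k ∨ (¬ X.Rejected J c nrm A k ∧ ¬ X.FeasTest J c nrm A k)

/-- A run that never fails in the restoration phase, with the sufficient Cauchy decrease. -/
structure IsInfiniteRun (J : (DOF P Q R d → ℝ) → ℝ) (c : (DOF P Q R d → ℝ) → P → ℝ)
    (nrm : (DOF P Q R d → ℝ) → P → Fin d → ℝ) (L : Set (DOF P Q R d → ℝ)) (A : Params)
    (χ : (DOF P Q R d → ℝ) → ℝ) (κ : ℝ) (X : Trace P Q R d) : Prop where
  radius_zero : 0 < X.Δ 0
  filter_zero : X.F 0 = ∅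
  regular : ∀ k, ¬ X.Inadmissible c k → X.RegularStep J c nrm A k
  restoration : ∀ k, X.Inadmissible c k → X.RestorationStep J c A k
  not_fails : ∀ k, ¬ X.RestorationFails J c A k
  mem : ∀ k, X.z k ∈ L
  measure_nonneg : ∀ z ∈ L, 0 ≤ χ z
  pos : 0 < κ
  cauchy : ∀ k, ¬ X.Inadmissible c k → κ * χ (X.z k) * cauchyLength (χ (X.z k))
    (opNorm (hessT c nrm J (X.z k))) (X.Δ k) ≤ X.pred J c nrm k

theorem infeas_le_radius {k : ℕ} (hΔ : 0 ≤ X.Δ k) (h : ¬ X.Inadmissible c k) :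
    infeas c (X.z k) ≤ X.Δ k := by
  rw [Inadmissible] at h
  push Not at h
  exact (infeas_le_iff hΔ).2 h

theorem radius_lt_infeas {k : ℕ} (h : X.Inadmissible c k) : X.Δ k < infeas c (X.z k) := by
  obtain ⟨p, hp⟩ := h
  have := (infeas_le_iff (infeas_nonneg c (X.z k))).1 le_rfl p
  linarith

theorem pred_eq (k : ℕ) : X.pred J c nrm k = - model c nrm J (X.z k) (X.u k) := by
  rw [pred, model_zero, zero_sub]

theorem opNorm_nonneg {ι : Type*} [Fintype ι] [DecidableEq ι] (M : Matrix ι ι ℝ) :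
    0 ≤ opNorm M := norm_nonneg _

namespace IsInfiniteRun

variable (hX : X.IsInfiniteRun J c nrm L A χ κ)

include hX

theorem filter_succ (k : ℕ) :
    (X.Adds J c nrm A k ∧ X.F (k + 1) = addToFilter A.ξ (X.F k) (pair J c (X.z k))) ∨
      (¬ X.Adds J c nrm A k ∧ X.F (k + 1) = X.F k) := by
  by_cases hi : X.Inadmissible c k
  · exact Or.inl ⟨Or.inl hi, (hX.restoration k hi).filter⟩
  have hr := hX.regular k hi
  by_cases hrej : X.Rejected J c nrm A k
  · refine Or.inr ⟨?_, (hr.reject hrej).2.1⟩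
    rintro (h | h)
    exacts [hi h, h.1 hrej]
  by_cases hf : X.FeasTest J c nrm A k
  · refine Or.inr ⟨?_, (hr.energyType hrej hf).2.1⟩
    rintro (h | h)
    exacts [hi h, h.2 hf]
  · exact Or.inl ⟨Or.inr ⟨hrej, hf⟩, (hr.infeasType hrej hf).2.1⟩

theorem acceptable_antitone {l k : ℕ} (hlk : l ≤ k) {b : ℝ × ℝ}
    (h : Acceptable A.ξ (X.F k) b) : Acceptable A.ξ (X.F l) b := by
  induction k, hlk using Nat.le_induction with
  | base => exact h
  | succ k _ ih =>
    rcases hX.filter_succ k with h1 | h1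
    · rw [h1.2] at h
      exact ih (h.of_addToFilter A.hξ (infeas_nonneg c _))
    · rw [h1.2] at h
      exact ih h

theorem acceptable_cand {k : ℕ} (hi : ¬ X.Inadmissible c k) (h : ¬ X.Rejected J c nrm A k) :
    Acceptable A.ξ (X.F k) (pair J c (X.cand c nrm k)) := by
  rw [Rejected, not_or, not_not] at h
  exact h.1.mono (hX.regular k hi).test_lower

theorem next_eq_cand {k : ℕ} (hi : ¬ X.Inadmissible c k) (h : ¬ X.Rejected J c nrm A k) :
    X.z (k + 1) = X.cand c nrm k := by
  by_cases hf : X.FeasTest J c nrm A k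
  · exact ((hX.regular k hi).energyType h hf).1
  · exact ((hX.regular k hi).infeasType h hf).1

/-- A candidate is certain to be tested only against the filter before the current pair enters it.
An iterate after `l` is thus compared with all pairs added before `l`, but perhaps not with the pair
of `l` itself. -/
theorem acceptable_of_adds (k : ℕ) : ∀ l < k, X.Adds J c nrm A l →
    Acceptable A.ξ (X.F l) (pair J c (X.z k)) := by
  induction k with
  | zero => intro l hl; omega
  | succ k ih =>
    intro l hl hadd
    have hlk : l ≤ k := by omega
    by_cases hi : X.Inadmissible c k
    · exact hX.acceptable_antitone hl.le
        ((hX.restoration k hi).success (hX.not_fails k)).2.1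
    by_cases hrej : X.Rejected J c nrm A k
    · rw [((hX.regular k hi).reject hrej).1]
      refine ih l (lt_of_le_of_ne hlk ?_) hadd
      rintro rfl
      rcases hadd with h | h
      exacts [hi h, h.1 hrej]
    · rw [hX.next_eq_cand hi hrej]
      exact hX.acceptable_antitone hlk (hX.acceptable_cand hi hrej)

/-- The intermediate addition `l` makes sure that the pair of `i` was in the filter, or dominated by
a later pair, when the comparison was made. -/
theorem acceptable_pair_of_adds {i l k : ℕ} (hil : i < l) (hlk : l < k)
    (hi : X.Adds J c nrm A i) (hl : X.Adds J c nrm A l) :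
    (pair J c (X.z k)).1 < (pair J c (X.z i)).1 - A.ξ * (pair J c (X.z k)).2 ∨
      (pair J c (X.z k)).2 < (1 - A.ξ) * (pair J c (X.z i)).2 := by
  have h := hX.acceptable_antitone (Nat.succ_le_of_lt hil)
    (hX.acceptable_of_adds k l hlk hl)
  rcases hX.filter_succ i with h1 | h1
  · rw [h1.2] at h
    exact h _ (Set.mem_insert _ _)
  · exact absurd hi h1.1

/-- The infeasibility tends to zero along the iterations in which the filter is extended. -/
theorem infeas_lt_of_adds (hL : IsCompact L) (hJ : ContinuousOn J L)
    (hc : ContinuousOn (infeas c) L) {δ : ℝ} (hδ : 0 < δ) :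
    ∃ K, ∀ k ≥ K, X.Adds J c nrm A k → infeas c (X.z k) < δ := by
  by_contra! hcon
  have hfreq : ∃ᶠ k in atTop, X.Adds J c nrm A k ∧ δ ≤ infeas c (X.z k) :=
    frequently_atTop.2 fun a => by
      obtain ⟨k, hk, h⟩ := hcon a
      exact ⟨k, hk, h⟩
  obtain ⟨φ, hφ, hφP⟩ := extraction_of_frequently_atTop hfreq
  obtain ⟨w, hw, ψ, hψ, hlim⟩ := hL.tendsto_subseq fun n => hX.mem (φ n)
  have hlim' : Tendsto (fun n => X.z (φ (ψ n))) atTop (𝓝[L] w) :=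
    tendsto_nhdsWithin_iff.2 ⟨hlim, Eventually.of_forall fun n => hX.mem _⟩
  have hJl := (hJ w hw).tendsto.comp hlim'
  have hcl := (hc w hw).tendsto.comp hlim'
  have hJl2 := hJl.comp (tendsto_add_atTop_nat 2)
  have hcl2 := hcl.comp (tendsto_add_atTop_nat 2)
  have hcw : δ ≤ infeas c w := ge_of_tendsto' hcl fun n => (hφP _).2
  have hξ := A.hξ
  -- Two terms of a convergent subsequence differ by a null sequence, while the margins tend to
  -- $\xi\vartheta(w)>0$; so both alternatives of acceptability fail. The shift by two leaves room
  -- for the intermediate addition.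
  have e1 : ∀ᶠ n in atTop, (J (X.z (φ (ψ n)))) - A.ξ * infeas c (X.z (φ (ψ (n + 2))))
      < J (X.z (φ (ψ (n + 2)))) := by
    refine (hJl.sub (hcl2.const_mul A.ξ)).eventually_lt hJl2 ?_
    have : 0 < A.ξ * infeas c w := mul_pos hξ.1 (hδ.trans_le hcw)
    linarith
  have e2 : ∀ᶠ n in atTop, (1 - A.ξ) * infeas c (X.z (φ (ψ n)))
      < infeas c (X.z (φ (ψ (n + 2)))) := by
    refine (hcl.const_mul (1 - A.ξ)).eventually_lt hcl2 ?_
    have : 0 < A.ξ * infeas c w := mul_pos hξ.1 (hδ.trans_le hcw)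
    linarith
  obtain ⟨n, h1, h2⟩ := (e1.and e2).exists
  have hmono := hφ.comp hψ
  rcases hX.acceptable_pair_of_adds (hmono (Nat.lt_succ_self n)) (hmono (Nat.lt_succ_self (n + 1)))
    (hφP _).1 (hφP _).1 with h | h
  · exact absurd h h1.not_gt
  · exact absurd h h2.not_gt

theorem cauchyLength_nonneg {k : ℕ} (hΔ : 0 ≤ X.Δ k) :
    0 ≤ cauchyLength (χ (X.z k)) (opNorm (hessT c nrm J (X.z k))) (X.Δ k) := by
  rw [cauchyLength]
  split_ifs
  · exact hΔ
  · exact le_min (div_nonneg (hX.measure_nonneg _ (hX.mem k)) (opNorm_nonneg _)) hΔ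

theorem pred_nonneg {k : ℕ} (hΔ : 0 ≤ X.Δ k) (hi : ¬ X.Inadmissible c k) :
    0 ≤ X.pred J c nrm k :=
  (mul_nonneg (mul_nonneg hX.pos.le (hX.measure_nonneg _ (hX.mem k)))
    (hX.cauchyLength_nonneg hΔ)).trans (hX.cauchy k hi)

/-- A feasible iterate passes the feasibility test, as the predicted reduction is nonnegative, and
its sub-problem is admissible. -/
theorem infeas_pos_of_adds {k : ℕ} (hΔ : 0 ≤ X.Δ k) (h : X.Adds J c nrm A k) :
    0 < infeas c (X.z k) := by
  by_cases hi : X.Inadmissible c k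
  · exact hΔ.trans_lt (radius_lt_infeas hi)
  rcases h with h | h
  · exact absurd h hi
  · refine (infeas_nonneg c _).lt_of_ne fun h0 => h.2 ?_
    rw [FeasTest, ← h0]
    simpa using hX.pred_nonneg hΔ hi

theorem exists_filter_lower_bound (hΔ : ∀ k, 0 < X.Δ k) (k : ℕ) :
    ∃ t > 0, ∀ b ∈ X.F k, t ≤ b.2 := by
  induction k with
  | zero => exact ⟨1, one_pos, by simp [hX.filter_zero]⟩
  | succ k ih =>
    obtain ⟨t, ht, h⟩ := ih
    rcases hX.filter_succ k with h1 | h1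
    · refine ⟨min t (infeas c (X.z k)), lt_min ht (hX.infeas_pos_of_adds (hΔ k).le h1.1), ?_⟩
      rw [h1.2]
      rintro b (rfl | hb)
      · exact min_le_right _ _
      · exact (min_le_left _ _).trans (h b hb.1)
    · rw [h1.2]
      exact ⟨t, ht, h⟩

theorem radius_nonneg (k : ℕ) : 0 ≤ X.Δ k := by
  induction k with
  | zero => exact hX.radius_zero.le
  | succ k ih =>
    by_cases hi : X.Inadmissible c k
    · exact ((hX.restoration k hi).success (hX.not_fails k)).2.2.1.le
    by_cases hrej : X.Rejected J c nrm A k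
    · exact (mul_nonneg A.hγ.1.le (le_min (norm_nonneg _) ih)).trans
        ((hX.regular k hi).reject hrej).2.2.1
    by_cases hf : X.FeasTest J c nrm A k
    · exact ih.trans ((hX.regular k hi).energyType hrej hf).2.2.1
    · rw [((hX.regular k hi).infeasType hrej hf).2.2]
      exact ih

/-- If the radius collapses, then the method has stopped at a critical point. -/
theorem exists_constant_of_radius_eq_zero {k : ℕ} (h : X.Δ k = 0) :
    ∃ K, (∀ j ≥ K, X.z j = X.z K) ∧ χ (X.z K) = 0 ∧ ∀ p, 0 ≤ c (X.z K) p := by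
  classical
  have hex : ∃ k, X.Δ k = 0 := ⟨k, h⟩
  have hm0 : Nat.find hex ≠ 0 := fun h0 => by
    have := Nat.find_spec hex
    rw [h0] at this
    exact hX.radius_zero.ne' this
  obtain ⟨K, hK⟩ := Nat.exists_eq_succ_of_ne_zero hm0
  have hz : X.Δ (K + 1) = 0 := by
    have := Nat.find_spec hex
    rwa [hK] at this
  have hpos : 0 < X.Δ K := (hX.radius_nonneg K).lt_of_ne
    fun h0 => Nat.find_min hex (by omega) h0.symm
  have hi : ¬ X.Inadmissible c K := fun hi =>
    (((hX.restoration K hi).success (hX.not_fails K)).2.2.1).ne' hz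
  have hr := hX.regular K hi
  have hrej : X.Rejected J c nrm A K := by
    by_contra hrej
    by_cases hf : X.FeasTest J c nrm A K
    · have := (hr.energyType hrej hf).2.2.1
      linarith
    · have := (hr.infeasType hrej hf).2.2
      linarith
  -- A positive radius can drop to zero only through the lower bound $\gamma_0\min\{\|\tilde
  -- u\|,\Delta\}$, which forces a zero correction.
  have hu : X.u K = 0 := by
    have h1 := (hr.reject hrej).2.2.1
    rw [hz, min_eq_left (hr.feasible.norm_le hpos.le)] at h1
    have h2 : ‖X.u K‖ ≤ 0 := nonpos_of_mul_nonpos_right h1 A.hγ.1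
    exact norm_le_zero_iff.1 h2
  have hc : ∀ p, 0 ≤ c (X.z K) p := fun p => by
    have := (hr.feasible (Sum.inl (p, 0))).2
    rw [hu] at this
    simp only [Pi.zero_apply, upperBound, Sum.elim_inl, if_true] at this
    exact this.trans (min_le_left _ _)
  have hχ : χ (X.z K) = 0 := by
    by_contra hne
    have hχ : 0 < χ (X.z K) := (hX.measure_nonneg _ (hX.mem K)).lt_of_ne (Ne.symm hne)
    have h1 := hX.cauchy K hi
    rw [pred_eq, hu, model_zero, neg_zero] at h1
    have h2 : 0 < cauchyLength (χ (X.z K)) (opNorm (hessT c nrm J (X.z K))) (X.Δ K) := by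
      rw [cauchyLength]
      split_ifs with h0
      · exact hpos
      · exact lt_min (div_pos hχ ((opNorm_nonneg _).lt_of_ne (Ne.symm h0))) hpos
    have := mul_pos (mul_pos hX.pos hχ) h2
    linarith
  -- With radius zero the correction and the predicted reduction vanish; then $\rho=0<\eta_1$ and
  -- the test reads $0\ge 0$, so every later iteration is a rejection.
  have hstay : ∀ j ≥ K + 1, X.z j = X.z K ∧ X.Δ j = 0 := by
    intro j hj
    induction j, hj using Nat.le_induction with
    | base => exact ⟨(hr.reject hrej).1, hz⟩
    | succ j _ ih =>
      have hij : ¬ X.Inadmissible c j := by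
        rintro ⟨p, hp⟩
        rw [ih.1, ih.2] at hp
        linarith [hc p]
      have hrj := hX.regular j hij
      have huj : X.u j = 0 := norm_le_zero_iff.1 (ih.2 ▸ hrj.feasible.norm_le ih.2.ge)
      have hpj : X.pred J c nrm j = 0 := by rw [pred_eq, huj, model_zero, neg_zero]
      have hrejj : X.Rejected J c nrm A j := by
        refine Or.inr ⟨?_, ?_⟩
        · rw [ratio, hpj, div_zero]
          exact A.hη.1
        · have : infeas c (X.z j) = 0 := le_antisymm
            ((infeas_le_radius ih.2.ge hij).trans ih.2.le) (infeas_nonneg _ _)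
          rw [FeasTest, hpj, this]
          simp
      obtain ⟨h1, -, -, h4⟩ := hrj.reject hrejj
      rw [ih.2, mul_zero] at h4
      exact ⟨h1.trans ih.1, le_antisymm h4 (hX.radius_nonneg _)⟩
  refine ⟨K, fun j hj => ?_, hχ, hc⟩
  rcases hj.eq_or_lt with rfl | hlt
  · rfl
  · exact (hstay j hlt).1

end IsInfiniteRun

end Trace

end FilterFacts

/-! ### Small radii, and the two cases of infinitely and finitely many filter additions. -/

section Convergence

variable {P Q R : Type*} [Fintype P] [DecidableEq P] [Fintype Q] [DecidableEq Q]
  [Fintype R] [DecidableEq R] {d : ℕ} [NeZero d]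
  {J : (DOF P Q R d → ℝ) → ℝ} {c : (DOF P Q R d → ℝ) → P → ℝ}
  {nrm : (DOF P Q R d → ℝ) → P → Fin d → ℝ} {L : Set (DOF P Q R d → ℝ)}
  {A : Params} {X : Trace P Q R d} {χ : (DOF P Q R d → ℝ) → ℝ} {κ : ℝ}

namespace Trace

/-- What a small radius `Δ ≤ ρ` guarantees in a regular iteration at a point that is not critical
for the sub-problem (`ε ≤ χ`). -/
structure SmallRadius (J : (DOF P Q R d → ℝ) → ℝ) (c : (DOF P Q R d → ℝ) → P → ℝ)
    (nrm : (DOF P Q R d → ℝ) → P → Fin d → ℝ) (A : Params) (X : Trace P Q R d)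
    (χ : (DOF P Q R d → ℝ) → ℝ) (ε σ ρ C : ℝ) : Prop where
  σ_pos : 0 < σ
  ρ_pos : 0 < ρ
  C_pos : 0 < C
  pred_le : ∀ k, ¬ X.Inadmissible c k → ε ≤ χ (X.z k) →
    σ * min (X.Δ k) ρ ≤ X.pred J c nrm k
  radius_le : ∀ k, ¬ X.Inadmissible c k → ε ≤ χ (X.z k) → X.Rejected J c nrm A k →
    σ * min (X.Δ k) ρ ≤ X.Δ (k + 1)
  cand_le : ∀ k, ¬ X.Inadmissible c k → X.Δ k ≤ ρ → infeas c (X.cand c nrm k) ≤ C * X.Δ k ^ 2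
  feasTest : ∀ k, ¬ X.Inadmissible c k → ε ≤ χ (X.z k) → X.Δ k ≤ ρ → X.FeasTest J c nrm A k
  not_acceptable : ∀ k, ¬ X.Inadmissible c k → ε ≤ χ (X.z k) → X.Δ k ≤ ρ →
    X.Rejected J c nrm A k →
    ∃ b ∈ X.F k, b.1 < J (X.z k) ∧ (1 - A.ξ) * b.2 ≤ infeas c (X.cand c nrm k)

theorem min_le_cauchyLength {ε B x h Δ : ℝ} (hε : 0 < ε) (hx : ε ≤ x) (hh0 : 0 ≤ h) (hh : h ≤ B) :
    min Δ (ε / B) ≤ cauchyLength x h Δ := by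
  rw [cauchyLength]
  split_ifs with h0
  · exact min_le_left _ _
  · have hpos : 0 < h := hh0.lt_of_ne (Ne.symm h0)
    rw [min_comm]
    exact min_le_min_right _ (div_le_div₀ (hε.le.trans hx) hx hpos hh)

namespace IsInfiniteRun

variable (hX : X.IsInfiniteRun J c nrm L A χ κ)

include hX

theorem exists_smallRadius {B r : ℝ} (hB : ModelBounds J c nrm L B r) (hΔ : ∀ k, 0 < X.Δ k)
    {ε : ℝ} (hε : 0 < ε) : ∃ σ ρ C, SmallRadius J c nrm A X χ ε σ ρ C := by
  have hB0 : 0 < B := one_pos.trans_le hB.one_le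
  have hκ := hX.pos
  have hη := A.hη
  have hγ := A.hγ
  have hξ := A.hξ
  have hκε : 0 < κ * ε := mul_pos hκ hε
  have hpred : ∀ k, ¬ X.Inadmissible c k → ε ≤ χ (X.z k) →
      κ * ε * min (X.Δ k) (ε / B) ≤ X.pred J c nrm k := by
    intro k hi hχ
    refine le_trans ?_ (hX.cauchy k hi)
    have h1 := min_le_cauchyLength (Δ := X.Δ k) hε hχ (opNorm_nonneg _)
      (hB.hess_le _ (hX.mem k))
    have h2 : 0 ≤ min (X.Δ k) (ε / B) := le_min (hΔ k).le (by positivity)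
    have h3 : 0 ≤ κ * χ (X.z k) := mul_nonneg hκ.le (hε.le.trans hχ)
    gcongr
  have hη1 : 0 < 1 - A.η₁ := by linarith [hη.2.1, hη.2.2]
  -- `q` bounds $\|\tilde u\|$ from below: a correction that achieves the Cauchy decrease cannot be
  -- much shorter than the radius.
  set q : ℝ := min 1 (κ * ε / (2 * B)) with hq
  have hq0 : 0 < q := lt_min one_pos (by positivity)
  set σ : ℝ := min (κ * ε) (A.γ₀ * q) with hσ
  have hσ0 : 0 < σ := lt_min hκε (mul_pos hγ.1 hq0)
  -- In this order the bounds give the linear Cauchy decrease, the validity of the Taylor estimates,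
  -- the feasibility test, $\rho^k\ge\eta_1$, and an energy decrease that exceeds the filter margin.
  set ρ : ℝ := min (min (min (ε / B) r) σ)
    (min ((1 - A.η₁) * σ / B) (A.η₁ * σ / (2 * B))) with hρ
  have hρ0 : 0 < ρ :=
    lt_min (lt_min (lt_min (by positivity) hB.pos) hσ0)
      (lt_min (by positivity) (div_pos (mul_pos hη.1 hσ0) (by positivity)))
  have hρ1 : ρ ≤ ε / B := (min_le_left _ _).trans ((min_le_left _ _).trans (min_le_left _ _))
  have hρ2 : ρ ≤ r := (min_le_left _ _).trans ((min_le_left _ _).trans (min_le_right _ _))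
  have hρ3 : ρ ≤ σ := (min_le_left _ _).trans (min_le_right _ _)
  have hρ4 : B * ρ ≤ (1 - A.η₁) * σ := by
    have : ρ ≤ (1 - A.η₁) * σ / B := (min_le_right _ _).trans (min_le_left _ _)
    rw [le_div_iff₀ hB0] at this
    linarith
  have hρ5 : 2 * B * ρ ≤ A.η₁ * σ := by
    have : ρ ≤ A.η₁ * σ / (2 * B) := (min_le_right _ _).trans (min_le_right _ _)
    rw [le_div_iff₀ (by positivity)] at this
    linarith
  have hmin : ∀ k, 0 ≤ min (X.Δ k) ρ := fun k => le_min (hΔ k).le hρ0.le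
  have hpred' : ∀ k, ¬ X.Inadmissible c k → ε ≤ χ (X.z k) →
      σ * min (X.Δ k) ρ ≤ X.pred J c nrm k := fun k hi hχ =>
    (mul_le_mul (min_le_left _ _) (min_le_min_left _ hρ1) (hmin k) hκε.le).trans (hpred k hi hχ)
  have hcand : ∀ k, ¬ X.Inadmissible c k → X.Δ k ≤ ρ →
      infeas c (X.cand c nrm k) ≤ B * X.Δ k ^ 2 := fun k hi hk =>
    hB.infeas_le _ (hX.mem k) _ (hΔ k).le (hk.trans hρ2) _ (hX.regular k hi).feasible
  have hfeas : ∀ k, ¬ X.Inadmissible c k → ε ≤ χ (X.z k) → X.Δ k ≤ ρ →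
      X.FeasTest J c nrm A k := by
    intro k hi hχ hk
    have h1 := hpred' k hi hχ
    rw [min_eq_left hk] at h1
    have h2 := infeas_le_radius (hΔ k).le hi
    have h3 : infeas c (X.z k) ^ 2 ≤ X.Δ k ^ 2 := pow_le_pow_left₀ (infeas_nonneg _ _) h2 2
    have h4 := A.hκθ
    have h5 : X.Δ k * X.Δ k ≤ σ * X.Δ k :=
      mul_le_mul_of_nonneg_right (hk.trans hρ3) (hΔ k).le
    rw [FeasTest]
    nlinarith [sq_nonneg (infeas c (X.z k))]
  have henergy : ∀ k, ¬ X.Inadmissible c k → ε ≤ χ (X.z k) → X.Δ k ≤ ρ →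
      A.η₁ * X.pred J c nrm k ≤ J (X.z k) - J (X.cand c nrm k) ∧
        σ * X.Δ k ≤ X.pred J c nrm k := by
    intro k hi hχ hk
    have h1 := hpred' k hi hχ
    rw [min_eq_left hk] at h1
    have h2 := hB.energy_le _ (hX.mem k) _ (hΔ k).le (hk.trans hρ2) _ (hX.regular k hi).feasible
    have h3 : model c nrm J (X.z k) (X.u k) = - X.pred J c nrm k := by rw [pred_eq, neg_neg]
    rw [h3] at h2
    have h4 := (abs_le.1 h2).2
    have h5 : B * X.Δ k ^ 2 ≤ (1 - A.η₁) * (σ * X.Δ k) := by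
      have := mul_le_mul_of_nonneg_right
        ((mul_le_mul_of_nonneg_left hk hB0.le).trans hρ4) (hΔ k).le
      nlinarith
    have h6 := mul_le_mul_of_nonneg_left h1 hη1.le
    refine ⟨?_, h1⟩
    rw [cand]
    linarith
  refine ⟨σ, ρ, B, hσ0, hρ0, hB0, hpred', ?_, hcand, hfeas, ?_⟩
  · intro k hi hχ hrej
    have hr := hX.regular k hi
    have h1 := (hr.reject hrej).2.2.1
    rw [min_eq_left (hr.feasible.norm_le (hΔ k).le)] at h1
    have h2 := hpred' k hi hχ
    have h3 := (le_abs_self _).trans ((abs_neg _).trans_le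
      (hB.model_le _ (hX.mem k) (X.u k)))
    have h4 := hpred k hi hχ
    rw [pred_eq] at h4
    have h5 : q * min (X.Δ k) ρ ≤ ‖X.u k‖ := by
      -- For $\|\tilde u\|\le 1$ the quadratic term of the model bound is absorbed by the linear
      -- one.
      rcases le_or_gt ‖X.u k‖ 1 with hu | hu
      · have h6 : min (X.Δ k) ρ ≤ min (X.Δ k) (ε / B) := min_le_min_left _ hρ1
        have h7 : κ * ε * min (X.Δ k) ρ ≤ 2 * B * ‖X.u k‖ := by
          have h8 := mul_le_mul_of_nonneg_left h6 hκε.le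
          have h9 : ‖X.u k‖ ^ 2 ≤ ‖X.u k‖ := by nlinarith [norm_nonneg (X.u k)]
          have h10 := mul_le_mul_of_nonneg_left h9 hB0.le
          linarith
        have h8 : q * min (X.Δ k) ρ ≤ κ * ε / (2 * B) * min (X.Δ k) ρ :=
          mul_le_mul_of_nonneg_right (min_le_right _ _) (hmin k)
        refine h8.trans ?_
        rw [div_mul_eq_mul_div, div_le_iff₀ (by positivity)]
        linarith
      · have h6 : min (X.Δ k) ρ ≤ 1 := (min_le_right _ _).trans (hρ2.trans hB.le_one)
        have h7 : q * min (X.Δ k) ρ ≤ 1 * 1 := mul_le_mul (min_le_left _ _) h6 (hmin k) one_pos.le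
        linarith
    have h6 : σ * min (X.Δ k) ρ ≤ A.γ₀ * q * min (X.Δ k) ρ :=
      mul_le_mul_of_nonneg_right (min_le_right _ _) (hmin k)
    have h7 := mul_le_mul_of_nonneg_left h5 hγ.1.le
    linarith
  · intro k hi hχ hk hrej
    obtain ⟨he, hσp⟩ := henergy k hi hχ hk
    have hpp : 0 < X.pred J c nrm k := (mul_pos hσ0 (hΔ k)).trans_le hσp
    have hrej' : ¬ Acceptable A.ξ (X.G k) (pair J c (X.cand c nrm k)) := by
      rcases hrej with h | h
      · exact h
      · refine absurd h.1 (not_lt.2 ?_)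
        rw [ratio, le_div_iff₀ hpp]
        exact he
    have hdec : J (X.cand c nrm k) + A.ξ * infeas c (X.cand c nrm k) < J (X.z k) := by
      have h1 := hcand k hi hk
      have h2 : A.ξ * infeas c (X.cand c nrm k) ≤ 1 * (B * X.Δ k ^ 2) :=
        mul_le_mul hξ.2.le h1 (infeas_nonneg _ _) zero_le_one
      have h3 : 2 * (B * X.Δ k ^ 2) ≤ A.η₁ * (σ * X.Δ k) := by
        have := mul_le_mul_of_nonneg_right
          ((mul_le_mul_of_nonneg_left hk (by positivity : 0 ≤ 2 * B)).trans hρ5) (hΔ k).le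
        nlinarith
      have h4 := mul_le_mul_of_nonneg_left hσp hη.1.le
      have h5 : 0 < B * X.Δ k ^ 2 := mul_pos hB0 (pow_pos (hΔ k) 2)
      linarith
    rw [Acceptable] at hrej'
    push Not at hrej'
    obtain ⟨b, hb, h1, h2⟩ := hrej'
    simp only [pair] at h1 h2
    -- The current pair cannot be the obstacle, since the energy falls by more than the margin.
    rcases (hX.regular k hi).test_upper hb with rfl | hbF
    · simp only [pair] at h1
      linarith
    · exact ⟨b, hbF, by linarith, h2⟩

/-- If the filter is extended infinitely often, then the method gets close to critical points. -/
theorem not_frequently_adds (hL : IsCompact L) (hJ : ContinuousOn J L)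
    (hc : ContinuousOn (infeas c) L) (hΔ : ∀ k, 0 < X.Δ k) {ε σ ρ C : ℝ} (hε : 0 < ε)
    (hS : SmallRadius J c nrm A X χ ε σ ρ C) {K₀ : ℕ}
    (hK₀ : ∀ k ≥ K₀, infeas c (X.z k) ≤ ε → ε ≤ χ (X.z k)) :
    ¬ ∃ᶠ k in atTop, X.Adds J c nrm A k := by
  intro hfreq
  rw [frequently_atTop] at hfreq
  obtain ⟨hσ, hρ, hC, hpred, hrad, hcand, hfeas, hnot⟩ := hS
  obtain ⟨K₁, hK₁⟩ := hX.infeas_lt_of_adds hL hJ hc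
    (lt_min (lt_min hε one_pos) (mul_pos hσ hρ))
  -- Late infeasibility is so small that an admissible sub-problem passes the feasibility test, for
  -- small and for large radii.
  have hinad : ∀ k ≥ max K₀ K₁, X.Adds J c nrm A k → X.Inadmissible c k := by
    intro k hk hadd
    by_contra hi
    have hlt := hK₁ k (le_of_max_le_right hk) hadd
    rw [lt_min_iff, lt_min_iff] at hlt
    obtain ⟨⟨h1, h2⟩, h3⟩ := hlt
    have hχ := hK₀ k (le_of_max_le_left hk) h1.le
    rcases hadd with h | ⟨-, h⟩
    · exact hi h
    rcases le_or_gt (X.Δ k) ρ with hle | hgt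
    · exact h (hfeas k hi hχ hle)
    · refine h ?_
      have h4 := hpred k hi hχ
      rw [min_eq_right hgt.le] at h4
      have h5 := infeas_nonneg c (X.z k)
      have h6 := A.hκθ
      rw [FeasTest]
      nlinarith [sq_nonneg (infeas c (X.z k))]
  obtain ⟨k₀, hk₀, hadd₀⟩ := hfreq (max K₀ K₁)
  -- From now on the filter grows only in restorations, and these end at a point acceptable to the
  -- enlarged filter.
  have hacc : ∀ j ≥ k₀ + 1, Acceptable A.ξ (X.F j) (pair J c (X.z j)) := by
    intro j hj
    induction j, hj using Nat.le_induction with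
    | base => exact ((hX.restoration k₀ (hinad k₀ hk₀ hadd₀)).success (hX.not_fails k₀)).2.1
    | succ j hj ih =>
      by_cases hi : X.Inadmissible c j
      · exact ((hX.restoration j hi).success (hX.not_fails j)).2.1
      rcases hX.filter_succ j with h | h
      · exact absurd (hinad j (hk₀.trans ((Nat.le_succ _).trans hj)) h.1) hi
      rw [h.2]
      by_cases hrej : X.Rejected J c nrm A j
      · rwa [((hX.regular j hi).reject hrej).1]
      · rw [hX.next_eq_cand hi hrej]
        exact hX.acceptable_cand hi hrej
  -- The thresholds $\varepsilon$, $\rho$ and $\sigma\rho$ make the small-radius estimates available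
  -- in the preceding iteration; $1/C$ refutes its acceptance and $\sigma^2/C$ its rejection.
  obtain ⟨K₂, hK₂⟩ := hX.infeas_lt_of_adds hL hJ hc
    (lt_min (lt_min (lt_min hε hρ) (mul_pos hσ hρ))
      (lt_min (div_pos one_pos hC) (div_pos (pow_pos hσ 2) hC)))
  obtain ⟨m, hm, haddm⟩ := hfreq (max (k₀ + 2) K₂)
  obtain ⟨j, rfl⟩ : ∃ j, m = j + 1 :=
    ⟨m - 1, by have := le_of_max_le_left hm; omega⟩
  have hj : k₀ + 1 ≤ j := by have := le_of_max_le_left hm; omega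
  have hjK : max K₀ K₁ ≤ j := hk₀.trans ((Nat.le_succ _).trans hj)
  have him : X.Inadmissible c (j + 1) := hinad _ (hjK.trans (Nat.le_succ _)) haddm
  have hlt := hK₂ _ (le_of_max_le_right hm) haddm
  rw [lt_min_iff, lt_min_iff, lt_min_iff, lt_min_iff, lt_div_iff₀ hC, lt_div_iff₀ hC] at hlt
  obtain ⟨⟨⟨h1, h2⟩, h3⟩, h4, h5⟩ := hlt
  have hrm := radius_lt_infeas him
  -- A restoration never directly follows another one.
  have hi : ¬ X.Inadmissible c j := fun hi =>
    ((hX.restoration j hi).success (hX.not_fails j)).2.2.2 him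
  by_cases hrej : X.Rejected J c nrm A j
  · rw [((hX.regular j hi).reject hrej).1] at h1 h2 h3 h4 h5 hrm
    have hχ := hK₀ j (le_of_max_le_left hjK) h1.le
    have h6 := hrad j hi hχ hrej
    have h7 : X.Δ j ≤ ρ := by
      by_contra hgt
      rw [min_eq_right (not_le.1 hgt).le] at h6
      linarith
    rw [min_eq_left h7] at h6
    obtain ⟨b, hb, hb1, hb2⟩ := hnot j hi hχ h7 hrej
    -- The blocking pair has lower energy than the iterate, so the iterate must beat it in
    -- infeasibility. Hence $\sigma\Delta_j<\vartheta(z_j)<C\Delta_j^2$, although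
    -- $C\vartheta(z_j)<\sigma^2$.
    rcases hacc j hj b hb with h | h
    · simp only [pair] at h
      have := mul_nonneg A.hξ.1.le (infeas_nonneg c (X.z j))
      linarith
    · simp only [pair] at h
      have h8 : infeas c (X.z j) < C * X.Δ j ^ 2 := (h.trans_le hb2).trans_le (hcand j hi h7)
      have h9 : σ * X.Δ j < infeas c (X.z j) := h6.trans_lt hrm
      have h10 : σ < C * X.Δ j := by
        have : σ * X.Δ j < C * X.Δ j * X.Δ j := by nlinarith
        exact lt_of_mul_lt_mul_right this (hΔ j).le
      have h11 : σ * (C * X.Δ j) < σ ^ 2 := by nlinarith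
      nlinarith
  · have hf : X.FeasTest J c nrm A j := by
      by_contra hf
      exact hi (hinad j hjK (Or.inr ⟨hrej, hf⟩))
    -- Now $\Delta_j\le\Delta_{j+1}<\vartheta(z_{j+1})\le C\Delta_j^2$ contradicts
    -- $C\vartheta(z_{j+1})<1$.
    obtain ⟨hz, -, hge, -⟩ := (hX.regular j hi).energyType hrej hf
    have h6 := hcand j hi (by linarith)
    rw [← hz] at h6
    have h7 : X.Δ j < infeas c (X.z (j + 1)) := hge.trans_lt hrm
    have h8 := hΔ j
    have h9 : X.Δ j ^ 2 ≤ infeas c (X.z (j + 1)) ^ 2 := pow_le_pow_left₀ h8.le h7.le 2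
    have h10 : C * X.Δ j ^ 2 ≤ C * infeas c (X.z (j + 1)) ^ 2 :=
      mul_le_mul_of_nonneg_left h9 hC.le
    nlinarith

/-- If the filter is extended only finitely often, then the method gets close to critical
points. -/
theorem not_eventually_not_adds (hL : IsCompact L) (hJ : ContinuousOn J L)
    (hΔ : ∀ k, 0 < X.Δ k) {ε σ ρ C : ℝ} (hε : 0 < ε)
    (hS : SmallRadius J c nrm A X χ ε σ ρ C) {K₀ : ℕ}
    (hK₀ : ∀ k ≥ K₀, infeas c (X.z k) ≤ ε → ε ≤ χ (X.z k)) :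
    ¬ ∀ᶠ k in atTop, ¬ X.Adds J c nrm A k := by
  intro hev
  rw [eventually_atTop] at hev
  obtain ⟨K₁, hK₁⟩ := hev
  obtain ⟨hσ, hρ, hC, hpred, hrad, hcand, hfeas, hnot⟩ := hS
  have hη := A.hη
  have hκθ := A.hκθ
  have hadm : ∀ k ≥ K₁, ¬ X.Inadmissible c k := fun k hk hi => hK₁ k hk (Or.inl hi)
  have hF : ∀ k ≥ K₁, X.F k = X.F K₁ := by
    intro k hk
    induction k, hk using Nat.le_induction with
    | base => rfl
    | succ k hk ih =>
      rcases hX.filter_succ k with h | h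
      · exact absurd h.1 (hK₁ k hk)
      · rw [h.2, ih]
  have hstep : ∀ k ≥ K₁, ¬ X.Rejected J c nrm A k → X.FeasTest J c nrm A k := fun k hk hrej => by
    by_contra hf
    exact hK₁ k hk (Or.inr ⟨hrej, hf⟩)
  obtain ⟨t, ht, hFt⟩ := hX.exists_filter_lower_bound hΔ K₁
  have hξ1 : 0 < 1 - A.ξ := by linarith [A.hξ.2]
  -- Below this radius the candidate's infeasibility is at most $C\Delta^2\le(1-\xi)t/2$, which
  -- every pair of the fixed filter accepts.
  set ρ' : ℝ := min (min ρ 1) ((1 - A.ξ) * t / (2 * C)) with hρ'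
  have hρ'0 : 0 < ρ' := lt_min (lt_min hρ one_pos) (by positivity)
  have hρ'1 : ρ' ≤ ρ := (min_le_left _ _).trans (min_le_left _ _)
  have hρ'2 : ρ' ≤ 1 := (min_le_left _ _).trans (min_le_right _ _)
  have hρ'3 : ρ' * (2 * C) ≤ (1 - A.ξ) * t := (le_div_iff₀ (by positivity)).1 (min_le_right _ _)
  have haccept : ∀ k ≥ K₁, ε ≤ χ (X.z k) → X.Δ k ≤ ρ' → ¬ X.Rejected J c nrm A k := by
    intro k hk hχ hle hrej
    obtain ⟨b, hb, -, hb2⟩ := hnot k (hadm k hk) hχ (hle.trans hρ'1) hrej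
    rw [hF k hk] at hb
    have h1 := hb2.trans (hcand k (hadm k hk) (hle.trans hρ'1))
    have h2 := mul_le_mul_of_nonneg_left (hFt b hb) hξ1.le
    have h3 : X.Δ k ^ 2 ≤ ρ' := by nlinarith [hΔ k]
    have h4 := mul_le_mul_of_nonneg_left h3 hC.le
    nlinarith
  have hbelow : ∀ K₂ ≥ max K₀ K₁, (∀ k ≥ K₂, infeas c (X.z k) ≤ ε) →
      ∃ s > 0, ∀ k ≥ K₂, s ≤ X.Δ k := by
    intro K₂ hK₂ hinf
    refine ⟨min (X.Δ K₂) (σ * ρ'), lt_min (hΔ _) (mul_pos hσ hρ'0), fun k hk => ?_⟩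
    induction k, hk using Nat.le_induction with
    | base => exact min_le_left _ _
    | succ k hk ih =>
      have hk1 : K₁ ≤ k := (le_of_max_le_right hK₂).trans hk
      have hχ := hK₀ k ((le_of_max_le_left hK₂).trans hk) (hinf k hk)
      by_cases hrej : X.Rejected J c nrm A k
      · have h1 : ρ' < X.Δ k := by
          by_contra hle
          exact haccept k hk1 hχ (not_lt.1 hle) hrej
        refine (min_le_right _ _).trans (le_trans ?_ (hrad k (hadm k hk1) hχ hrej))
        exact mul_le_mul_of_nonneg_left (le_min h1.le hρ'1) hσ.le
      · exact ih.trans ((hX.regular k (hadm k hk1)).energyType hrej (hstep k hk1 hrej)).2.2.1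
  by_cases hacc : ∃ᶠ k in atTop, ¬ X.Rejected J c nrm A k
  · have hdec : ∀ k ≥ K₁, ¬ X.Rejected J c nrm A k →
        A.η₁ * X.pred J c nrm k ≤ J (X.z k) - J (X.z (k + 1)) := by
      intro k hk hrej
      have hf := hstep k hk hrej
      rw [hX.next_eq_cand (hadm k hk) hrej]
      have h1 : A.η₁ ≤ X.ratio J c nrm k := by
        by_contra hlt
        exact hrej (Or.inr ⟨not_le.1 hlt, hf⟩)
      rcases (hX.pred_nonneg (hΔ k).le (hadm k hk)).eq_or_lt with h0 | h0
      · rw [ratio, ← h0, div_zero] at h1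
        linarith
      · rwa [ratio, le_div_iff₀ h0] at h1
    have hanti : Antitone fun n => J (X.z (n + K₁)) := by
      refine antitone_nat_of_succ_le fun n => ?_
      have hn : K₁ ≤ n + K₁ := Nat.le_add_left _ _
      rw [show n + 1 + K₁ = n + K₁ + 1 by omega]
      by_cases hrej : X.Rejected J c nrm A (n + K₁)
      · rw [((hX.regular _ (hadm _ hn)).reject hrej).1]
      · have h1 := hdec _ hn hrej
        have h2 := mul_nonneg hη.1.le (hX.pred_nonneg (hΔ _).le (hadm _ hn))
        linarith
    have hbdd : BddBelow (Set.range fun n => J (X.z (n + K₁))) := by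
      refine (hL.bddBelow_image hJ).mono ?_
      rintro _ ⟨n, rfl⟩
      exact ⟨_, hX.mem _, rfl⟩
    have hlim := tendsto_atTop_ciInf hanti hbdd
    have hdiff : Tendsto (fun n => J (X.z (n + K₁)) - J (X.z (n + 1 + K₁))) atTop (𝓝 0) := by
      simpa using hlim.sub ((tendsto_add_atTop_iff_nat 1).2 hlim)
    have hsmall : ∀ δ > 0, ∃ K, ∀ k ≥ K, ¬ X.Rejected J c nrm A k →
        X.pred J c nrm k < δ := by
      intro δ hδ
      obtain ⟨N, hN⟩ := eventually_atTop.1 (hdiff.eventually_lt_const (mul_pos hη.1 hδ))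
      refine ⟨N + K₁, fun k hk hrej => ?_⟩
      obtain ⟨n, rfl⟩ : ∃ n, k = n + K₁ := ⟨k - K₁, by omega⟩
      have h1 := hN n (by omega)
      have h2 := hdec _ (Nat.le_add_left _ _) hrej
      rw [show n + 1 + K₁ = n + K₁ + 1 by omega] at h1
      exact lt_of_mul_lt_mul_left (h2.trans_lt h1) hη.1.le
    obtain ⟨K₂, hK₂⟩ := hsmall (A.κθ * ε ^ 2) (mul_pos hκθ.1 (pow_pos hε 2))
    -- At accepted iterations the feasibility test bounds $\vartheta^2$ by the vanishing predicted
    -- reduction; any other iterate equals the one at the next acceptance.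
    have hinf : ∀ k ≥ max (max K₀ K₁) K₂, infeas c (X.z k) ≤ ε := by
      intro k hk
      obtain ⟨n, hn, hrej⟩ := frequently_atTop.1 hacc k
      have hex : ∃ n, k ≤ n ∧ ¬ X.Rejected J c nrm A n := ⟨n, hn, hrej⟩
      classical
      obtain ⟨hle, hnr⟩ := Nat.find_spec hex
      have hconst : ∀ j ≥ k, j ≤ Nat.find hex → X.z j = X.z k := by
        intro j hj
        induction j, hj using Nat.le_induction with
        | base => intro _; rfl
        | succ j hj ih =>
          intro hjf
          have hrejj : X.Rejected J c nrm A j := by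
            by_contra h
            exact Nat.find_min hex (Nat.lt_of_succ_le hjf) ⟨hj, h⟩
          have hj1 : K₁ ≤ j := (le_max_right _ _).trans ((le_of_max_le_left hk).trans hj)
          rw [((hX.regular j (hadm j hj1)).reject hrejj).1]
          exact ih ((Nat.le_succ _).trans hjf)
      rw [← hconst _ hle le_rfl]
      have hf1 : K₁ ≤ Nat.find hex := (le_max_right _ _).trans ((le_of_max_le_left hk).trans hle)
      have h1 := hK₂ _ ((le_of_max_le_right hk).trans hle) hnr
      have h2 := hstep _ hf1 hnr
      rw [FeasTest] at h2
      have h3 : infeas c (X.z (Nat.find hex)) ^ 2 ≤ ε ^ 2 :=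
        le_of_mul_le_mul_left (h2.trans h1.le) hκθ.1
      exact (pow_le_pow_iff_left₀ (infeas_nonneg _ _) hε.le two_ne_zero).1 h3
    obtain ⟨s, hs, hsΔ⟩ := hbelow _ (le_max_left _ _) hinf
    obtain ⟨K₃, hK₃⟩ := hsmall (σ * min s ρ) (mul_pos hσ (lt_min hs hρ))
    obtain ⟨k, hk, hrej⟩ := frequently_atTop.1 hacc (max (max (max K₀ K₁) K₂) K₃)
    have hk' := le_of_max_le_left hk
    have hk0 : max K₀ K₁ ≤ k := (le_max_left _ _).trans hk'
    have h1 := hK₃ k (le_of_max_le_right hk) hrej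
    have h2 := hpred k (hadm k (le_of_max_le_right hk0))
      (hK₀ k (le_of_max_le_left hk0) (hinf k hk'))
    have h3 : σ * min s ρ ≤ σ * min (X.Δ k) ρ :=
      mul_le_mul_of_nonneg_left (min_le_min_right _ (hsΔ k hk')) hσ.le
    linarith
  · rw [not_frequently, eventually_atTop] at hacc
    obtain ⟨K₂, hK₂⟩ := hacc
    simp only [not_not] at hK₂
    set K := max (max K₀ K₁) K₂ with hK
    have hK1 : K₁ ≤ K := (le_max_right _ _).trans (le_max_left _ _)
    have hstay : ∀ n, X.z (n + K) = X.z K ∧ X.Δ (n + K) ≤ A.γ₁ ^ n * X.Δ K := by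
      intro n
      induction n with
      | zero => simp
      | succ n ih =>
        have hn : K ≤ n + K := Nat.le_add_left _ _
        obtain ⟨h1, -, -, h4⟩ := (hX.regular _ (hadm _ (hK1.trans hn))).reject
          (hK₂ _ ((le_max_right _ _).trans hn))
        rw [show n + 1 + K = n + K + 1 by omega]
        refine ⟨h1.trans ih.1, h4.trans ?_⟩
        rw [pow_succ', mul_assoc]
        exact mul_le_mul_of_nonneg_left ih.2 (A.hγ.1.le.trans A.hγ.2.1)
    have hzero : Tendsto (fun n => A.γ₁ ^ n * X.Δ K) atTop (𝓝 0) := by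
      simpa using (tendsto_pow_atTop_nhds_zero_of_lt_one (A.hγ.1.le.trans A.hγ.2.1)
        A.hγ.2.2).mul_const (X.Δ K)
    -- The iterate is frozen and admissible for radii that tend to zero, so it is feasible. The
    -- lower bound `hbelow` of the radii then applies and contradicts their decay.
    have hinfK : infeas c (X.z K) ≤ 0 := by
      refine ge_of_tendsto' hzero fun n => ?_
      rw [← (hstay n).1]
      exact (infeas_le_radius (hΔ _).le (hadm _ (hK1.trans (Nat.le_add_left _ _)))).trans
        (hstay n).2
    obtain ⟨s, hs, hsΔ⟩ := hbelow K (le_max_left _ _) fun k hk => by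
      obtain ⟨n, rfl⟩ : ∃ n, k = n + K := ⟨k - K, by omega⟩
      rw [(hstay n).1]
      exact hinfK.trans hε.le
    have : s ≤ 0 := ge_of_tendsto' hzero fun n =>
      (hsΔ _ (Nat.le_add_left _ _)).trans (hstay n).2
    linarith

theorem exists_subseq_critical (hL : IsCompact L) (hJ : ContinuousOn J L) (hc : ContinuousOn c L)
    (hχ : ContinuousOn χ L) {B r : ℝ} (hB : ModelBounds J c nrm L B r) :
    ∃ (φ : ℕ → ℕ) (w : DOF P Q R d → ℝ), StrictMono φ ∧ w ∈ L ∧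
      Tendsto (fun l => X.z (φ l)) atTop (𝓝 w) ∧ χ w = 0 ∧ ∀ p, 0 ≤ c w p := by
  by_cases h0 : ∃ k, X.Δ k = 0
  · obtain ⟨k, hk⟩ := h0
    obtain ⟨K, hK, h1, h2⟩ := hX.exists_constant_of_radius_eq_zero hk
    refine ⟨id, X.z K, strictMono_id, hX.mem K, ?_, h1, h2⟩
    exact tendsto_const_nhds.congr' (eventually_atTop.2 ⟨K, fun j hj => (hK j hj).symm⟩)
  push Not at h0
  have hΔ : ∀ k, 0 < X.Δ k := fun k => (hX.radius_nonneg k).lt_of_ne (h0 k).symm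
  have hcinf : ContinuousOn (infeas c) L := by
    refine ContinuousOn.finset_sup'_apply Finset.univ_nonempty fun o _ => ?_
    rcases o with _ | p
    · exact continuousOn_const
    · exact ((continuous_apply p).comp_continuousOn hc).neg
  -- The failure of this claim for one `n` is the hypothesis of both case lemmas, with
  -- $\varepsilon=1/(n+1)$.
  have hfreq : ∀ n : ℕ, ∃ᶠ k in atTop,
      infeas c (X.z k) ≤ 1 / ((n : ℝ) + 1) ∧ χ (X.z k) ≤ 1 / ((n : ℝ) + 1) := by
    intro n hcon
    have hε : 0 < 1 / ((n : ℝ) + 1) := by positivity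
    obtain ⟨K₀, hK₀⟩ := eventually_atTop.1 hcon
    have hK₀' : ∀ k ≥ K₀, infeas c (X.z k) ≤ 1 / ((n : ℝ) + 1) →
        1 / ((n : ℝ) + 1) ≤ χ (X.z k) := fun k hk h =>
      (not_le.1 fun h' => hK₀ k hk ⟨h, h'⟩).le
    obtain ⟨σ, ρ, C, hS⟩ := hX.exists_smallRadius hB hΔ hε
    refine hX.not_eventually_not_adds hL hJ hΔ hε hS hK₀' ?_
    have := hX.not_frequently_adds hL hJ hcinf hΔ hε hS hK₀'
    rwa [not_frequently] at this
  obtain ⟨φ, hφ, hφP⟩ := extraction_forall_of_frequently hfreq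
  obtain ⟨w, hw, ψ, hψ, hlim⟩ := hL.tendsto_subseq fun n => hX.mem (φ n)
  have hlim' : Tendsto (fun n => X.z (φ (ψ n))) atTop (𝓝[L] w) :=
    tendsto_nhdsWithin_iff.2 ⟨hlim, Eventually.of_forall fun n => hX.mem _⟩
  have hone : Tendsto (fun n => 1 / ((ψ n : ℝ) + 1)) atTop (𝓝 0) :=
    tendsto_one_div_add_atTop_nhds_zero_nat.comp hψ.tendsto_atTop
  have h1 : infeas c w ≤ 0 :=
    le_of_tendsto_of_tendsto' ((hcinf w hw).tendsto.comp hlim') hone fun n => (hφP (ψ n)).1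
  have h2 : χ w ≤ 0 :=
    le_of_tendsto_of_tendsto' ((hχ w hw).tendsto.comp hlim') hone fun n => (hφP (ψ n)).2
  exact ⟨φ ∘ ψ, w, hφ.comp hψ, hw, hlim, le_antisymm h2 (hX.measure_nonneg w hw), fun p => by
    simpa using (infeas_le_iff le_rfl).1 h1 p⟩

end IsInfiniteRun

end Trace

end Convergence

end FilterContact

end

/-! ### The convergence theorem. -/

theorem theorem4p1 {P Q R : Type*} [Fintype P] [DecidableEq P] [Fintype Q] [DecidableEq Q]
    [Fintype R] [DecidableEq R] {d : ℕ} [NeZero d]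
    (J : (FilterContact.DOF P Q R d → ℝ) → ℝ)
    (c : (FilterContact.DOF P Q R d → ℝ) → P → ℝ)
    (nrm : (FilterContact.DOF P Q R d → ℝ) → P → Fin d → ℝ)
    (L U : Set (FilterContact.DOF P Q R d → ℝ))
    (hL : IsCompact L) (hU : IsOpen U) (hLU : L ⊆ U)
    -- smoothness of the energy and of the contact constraint
    (hJ : ContDiffOn ℝ 2 J U) (hc : ContDiffOn ℝ 2 c U)
    -- the constraint does not depend on the degrees of freedom off the contact boundaries
    (hc0 : ∀ z ∈ L, ∀ (p : P) (a : R × Fin d), FilterContact.jac c z p (Sum.inr (Sum.inr a)) = 0)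
    -- the contact normals are unit vectors
    (hnrm : ∀ z ∈ L, ∀ p, nrm z p ⬝ᵥ nrm z p = 1)
    -- the normal non-mortar matrix and its lumped approximation have bounded inverses
    (κN : ℝ)
    (hN : ∀ z ∈ L, IsUnit (FilterContact.nmNormal c nrm z) ∧
      FilterContact.opNorm (FilterContact.nmNormal c nrm z)⁻¹ ≤ κN)
    (hNl : ∀ z ∈ L, IsUnit (FilterContact.nmLumped c nrm z) ∧
      FilterContact.opNorm (FilterContact.nmLumped c nrm z)⁻¹ ≤ κN)
    -- the filter-trust-region method, with iterates in the compact set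
    (A : FilterContact.Params) (X : FilterContact.Trace P Q R d)
    (hX : X.IsRun J c nrm A)
    (hXL : ∀ k, X.Reached J c A k → X.z k ∈ L)
    -- sufficient Cauchy decrease
    (χ : (FilterContact.DOF P Q R d → ℝ) → ℝ)
    (hχ : FilterContact.IsOptimalityMeasure c nrm J L χ)
    (κscd : ℝ) (hκscd : 0 < κscd)
    (hCauchy : ∀ k, X.Reached J c A k → ¬ X.Inadmissible c k →
      κscd * χ (X.z k) * FilterContact.cauchyLength (χ (X.z k))
        (FilterContact.opNorm (FilterContact.hessT c nrm J (X.z k))) (X.Δ k)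
        ≤ X.pred J c nrm k) :
    (∃ k, X.Reached J c A k ∧ X.RestorationFails J c A k) ∨
    ((∀ k, ¬ X.RestorationFails J c A k) ∧
      ∃ (φ : ℕ → ℕ) (zs : FilterContact.DOF P Q R d → ℝ), StrictMono φ ∧
        Tendsto (fun l => X.z (φ l)) atTop (𝓝 zs) ∧
        FilterContact.FirstOrderCritical J c zs) := by
  by_cases hfail : ∃ k, X.RestorationFails J c A k
  · classical
    -- The first failure is taken, since an iteration counts as reached only if no earlier
    -- restoration has failed.
    exact Or.inl ⟨Nat.find hfail, fun j hj => Nat.find_min hfail hj, Nat.find_spec hfail⟩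
  push Not at hfail
  have hR : ∀ k, X.Reached J c A k := fun k j _ => hfail j
  obtain ⟨B, r, hB⟩ := FilterContact.exists_modelBounds hL hU hLU hJ hc hc0 κN hN hNl
  have hrun : X.IsInfiniteRun J c nrm L A χ κscd :=
    { radius_zero := hX.radius_zero
      filter_zero := hX.filter_zero
      regular := fun k => hX.regular k (hR k)
      restoration := fun k => hX.restoration k (hR k)
      not_fails := hfail
      mem := fun k => hXL k (hR k)
      measure_nonneg := hχ.2.1
      pos := hκscd
      cauchy := fun k => hCauchy k (hR k) }
  obtain ⟨φ, w, hφ, hw, hlim, hχw, hcw⟩ := hrun.exists_subseq_critical hL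
    (hJ.continuousOn.mono hLU) (hc.continuousOn.mono hLU) hχ.1 hB
  exact Or.inr ⟨hfail, φ, w, hφ, hlim, FilterContact.firstOrderCritical_of_stationary
    (hN w hw).1 (hc0 w hw) hcw ((hχ.2.2 w hw hcw 1 one_pos).1 hχw)⟩
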